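/- Let $N\ge 1$ be an integer, $s>0$, $c>0$ and $v\in\mathbb{R}^N$. For $x\in\mathbb{R}^N\setminus\{-v\}$ put $$\kappa x:=c\,\frac{x+v}{|x+v|^2}-v,\qquad K_su(x):=|x+v|^{2s-N}\,u(\kappa x),$$ with $K_su$ extended by $0$ to $x=-v$. For $U\subset\mathbb{R}^N$ open, $C^\infty_c(U)$ denotes the smooth functions $\mathbb{R}^N\to\mathbb{R}$ whose support is a compact subset of $U$. For $u\in C_c^\infty(\mathbb{R}^N)$, $(-\Delta)^su$ denotes the iterated Laplacian $\big(-\sum_{i=1}^N\partial_i^2\big)^su$ if $s\in\mathbb{N}$, and if $s=m+\sigma$ with $m\in\mathbb{N}_0$, $\sigma\in(0,1)$, $$(-\Delta)^su(x):=\frac{c_{N,s}}{2}\int_{\mathbb{R}^N}\frac{\sum_{k=-m-1}^{m+1}(-1)^k\binom{2m+2}{m+1-k}u(x+ky)}{|y|^{N+2s}}\,dy,$$ $$c_{N,s}:=\frac{4^s\,\Gamma(\frac N2+s)}{\pi^{N/2}\,\Gamma(-s)}\Big(\sum_{k=1}^{m+1}(-1)^k\binom{2m+2}{m+1-k}k^{2s}\Big)^{-1}.$$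 Let $\mathcal{L}^1_s$ be the set of $u\in L^1_{loc}(\mathbb{R}^N)$ with $\int_{\mathbb{R}^N}\frac{|u(x)|}{1+|x|^{N+2s}}\,dx<\infty$. A function $u$ is called distributionally $s$-harmonic in an open set $U$ if $u\in\mathcal{L}^1_s$ and $\int_{\mathbb{R}^N}u(x)\,(-\Delta)^s\varphi(x)\,dx=0$ for all $\varphi\in C^\infty_c(U)$. Then: 1. For every $u\in C^\infty_c(\mathbb{R}^N\setminus\{-v\})$ and every $x\in\mathbb{R}^N\setminus\{-v\}$, $$(-\Delta)^s(K_su)(x)=c^{2s}\,\frac{K_s\big((-\Delta)^su\big)(x)}{|x+v|^{4s}},\quad\text{i.e.,}\quad (-\Delta)^s\Big(\frac{u\circ\kappa}{|\cdot+v|^{N-2s}}\Big)(x)=c^{2s}\,\frac{(-\Delta)^su(\kappa x)}{|x+v|^{N+2s}}.$$ 2. If $U\subset\mathbb{R}^N\setminus\{-v\}$ is open and $u\in\mathcal{L}^1_s$, then $u$ is distributionally $s$-harmonic in $U$ if and only if $K_su$ is distributionally $s$-harmonic in $\kappa(U)$. -/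

import Mathlib

open MeasureTheory
open scoped ContDiff Laplacian

noncomputable section

namespace PointInversion

/-- `φ ∈ C_c^∞(U)`: a smooth function on `ℝ^N` whose support is a compact subset of `U`. -/
def IsTestFunction {N : ℕ} (U : Set (EuclideanSpace ℝ (Fin N)))
    (φ : EuclideanSpace ℝ (Fin N) → ℝ) : Prop :=
  ContDiff ℝ ∞ φ ∧ HasCompactSupport φ ∧ tsupport φ ⊆ U

/-- The normalization constant
`c_{N,s} = 4^s Γ(N/2+s) / (π^{N/2} Γ(-s)) * (∑_{k=1}^{m+1} (-1)^k binom(2m+2, m+1-k) k^{2s})⁻¹`,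
for non-integer `s > 0` with integer part `m`. -/
def fracConst (N : ℕ) (s : ℝ) : ℝ :=
  (4 : ℝ) ^ s * Real.Gamma ((N : ℝ) / 2 + s) / (Real.pi ^ ((N : ℝ) / 2) * Real.Gamma (-s)) *
    (∑ k ∈ Finset.Icc 1 (⌊s⌋₊ + 1),
      (-1 : ℝ) ^ k * ((2 * ⌊s⌋₊ + 2).choose (⌊s⌋₊ + 1 - k) : ℝ) * (k : ℝ) ^ (2 * s))⁻¹

/-- The centered finite difference of order `2m+2`,
`∑_{k=-m-1}^{m+1} (-1)^k binom(2m+2, m+1-k) u(x + k y)`. -/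
def finiteDiff {N : ℕ} (m : ℕ) (u : EuclideanSpace ℝ (Fin N) → ℝ)
    (x y : EuclideanSpace ℝ (Fin N)) : ℝ :=
  ∑ k ∈ Finset.Icc (-((m : ℤ) + 1)) ((m : ℤ) + 1),
    (-1 : ℝ) ^ k * ((2 * m + 2).choose ((m : ℤ) + 1 - k).toNat : ℝ) * u (x + (k : ℝ) • y)

open Classical in
/-- The pointwise operator `(-Δ)^s`, `s > 0`: the iterated Laplacian if `s` is an integer, and
`c_{N,s}/2 * ∫ (∑_{k=-m-1}^{m+1} (-1)^k binom(2m+2, m+1-k) u(x + k y)) / |y|^{N+2s} dy`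
if `s = m + σ` with `m` a natural number and `σ ∈ (0,1)`. -/
def fracLaplacian {N : ℕ} (s : ℝ) (u : EuclideanSpace ℝ (Fin N) → ℝ)
    (x : EuclideanSpace ℝ (Fin N)) : ℝ :=
  if (⌊s⌋₊ : ℝ) = s then
    (fun w : EuclideanSpace ℝ (Fin N) → ℝ => -(Δ w))^[⌊s⌋₊] u x
  else
    fracConst N s / 2 * ∫ y, finiteDiff ⌊s⌋₊ u x y / ‖y‖ ^ ((N : ℝ) + 2 * s)

/-- The weighted space `𝓛¹_s` of locally integrable functions `u` on `ℝ^N` with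
`∫ |u(x)| / (1 + |x|^{N+2s}) dx < ∞`. -/
def MemL1s {N : ℕ} (s : ℝ) (u : EuclideanSpace ℝ (Fin N) → ℝ) : Prop :=
  LocallyIntegrable u ∧ Integrable fun x => |u x| / (1 + ‖x‖ ^ ((N : ℝ) + 2 * s))

/-- `u ∈ 𝓛¹_s` is `s`-harmonic in the distributional sense in `U`. -/
def IsDistribHarmonic {N : ℕ} (s : ℝ) (U : Set (EuclideanSpace ℝ (Fin N)))
    (u : EuclideanSpace ℝ (Fin N) → ℝ) : Prop :=
  MemL1s s u ∧
    ∀ φ : EuclideanSpace ℝ (Fin N) → ℝ, IsTestFunction U φ → ∫ x, u x * fracLaplacian s φ x = 0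

/-- The point inversion `κ x = c (x+v)/|x+v|² - v`, meant for `x ≠ -v`. -/
def inversion {N : ℕ} (c : ℝ) (v x : EuclideanSpace ℝ (Fin N)) : EuclideanSpace ℝ (Fin N) :=
  (c / ‖x + v‖ ^ 2) • (x + v) - v

open Classical in
/-- The transform `K_s u (x) = |x+v|^{2s-N} u(κ x)` for `x ≠ -v`, extended by zero to `x = -v`. -/
def kelvin {N : ℕ} (s c : ℝ) (v : EuclideanSpace ℝ (Fin N)) (u : EuclideanSpace ℝ (Fin N) → ℝ)
    (x : EuclideanSpace ℝ (Fin N)) : ℝ :=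
  if x = -v then 0 else ‖x + v‖ ^ (2 * s - (N : ℝ)) * u (inversion c v x)

end PointInversion

end

noncomputable section

namespace PointInversion

/-! Translations commute with `(-Δ)^s`, so everything reduces to `v = 0`. Off the origin the
inversion `κ` is a conformal involution with Jacobian `(c/|x|²)^N` and `|κx - κy| =
c|x-y|/(|x||y|)`.

For integer order, covariance follows by induction (`laplacian_iterate_kelvin`): raising the order
by one multiplies the transform by `|x|²`, and the commutator of `Δ^(m+1)` with `|x|²` produces
lower-order terms that cancel those of the Laplacian of `|x|^a (w ∘ κ)`.

For non-integer `s`, fix `m = ⌊s⌋` and let the order vary over complex `z` with `0 < Re z < m+1`,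
keeping the same difference of order `2m+2`. It is `O(|y|^(2m+2))` at `0`, so both sides are
holomorphic in `z` (`differentiableOn_integral_finiteDiff`), and by the identity theorem it suffices
to compare them at real orders `t < 1/2` (`integral_finiteDiff_kelvin`). There the weights sum to
zero, so the integral is a multiple of the absolutely convergent `∫ (g(x+y)-g(x)) |y|^(-N-2t) dy`.
Substituting `κ` (`integral_sub_kelvin`) gives the claim plus an error proportional to the same
integral for `|y|^(2t-N)`, which vanishes by antisymmetry under the inversion fixing the sphere
through the evaluation point.

The statement on distributions is dual: the transform maps test functions on `κ(U)` to test
functions on `U`, the Jacobian supplies exactly the missing powers, and applying the transform twice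
multiplies by `c^(2s-N)` off the origin. -/

/-- The Euclidean space `ℝ^N`. -/
abbrev Euc (N : ℕ) := EuclideanSpace ℝ (Fin N)

variable {N : ℕ} {c : ℝ}

/-! ### The point inversion centered at the origin -/

lemma inversion_zero (c : ℝ) (x : Euc N) : inversion c 0 x = (c / ‖x‖ ^ 2) • x := by
  simp [inversion]

lemma inversion_eq_euclideanGeometry (hc : 0 < c) :
    (inversion c 0 : Euc N → Euc N) = EuclideanGeometry.inversion 0 (√c) := by
  ext1 x
  simp [inversion_zero, EuclideanGeometry.inversion, div_pow, Real.sq_sqrt hc.le]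

lemma inversion_inversion (hc : 0 < c) (x : Euc N) : inversion c 0 (inversion c 0 x) = x := by
  rw [inversion_eq_euclideanGeometry hc]
  exact EuclideanGeometry.inversion_inversion _ (Real.sqrt_pos.2 hc).ne' x

@[simp] lemma inversion_zero_zero (c : ℝ) : inversion c 0 (0 : Euc N) = 0 := by
  simp [inversion_zero]

lemma inversion_eq_zero (hc : 0 < c) {x : Euc N} : inversion c 0 x = 0 ↔ x = 0 := by
  constructor
  · intro h
    rw [← inversion_inversion hc x, h, inversion_zero_zero]
  · rintro rfl
    simp

lemma norm_inversion (hc : 0 < c) (x : Euc N) : ‖inversion c 0 x‖ = c / ‖x‖ := by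
  rw [inversion_zero, norm_smul, Real.norm_of_nonneg (by positivity)]
  rcases eq_or_ne x 0 with rfl | hx
  · simp
  · have := norm_pos_iff.2 hx
    field_simp

lemma norm_inversion_sub_inversion (hc : 0 < c) {x y : Euc N} (hx : x ≠ 0) (hy : y ≠ 0) :
    ‖inversion c 0 x - inversion c 0 y‖ = c * ‖x - y‖ / (‖x‖ * ‖y‖) := by
  have := EuclideanGeometry.dist_inversion_inversion hx hy (√c)
  rw [← inversion_eq_euclideanGeometry hc, dist_zero_right, dist_zero_right, dist_eq_norm,
    dist_eq_norm, Real.sq_sqrt hc.le] at this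
  rw [this]
  ring

lemma hasFDerivAt_inversion (hc : 0 < c) {x : Euc N} (hx : x ≠ 0) :
    HasFDerivAt (inversion c 0)
      ((c / ‖x‖ ^ 2) • ((ℝ ∙ x)ᗮ.reflection : Euc N →L[ℝ] Euc N)) x := by
  have := EuclideanGeometry.hasFDerivAt_inversion (R := √c) hx
  rw [← inversion_eq_euclideanGeometry hc] at this
  simpa [div_pow, Real.sq_sqrt hc.le] using this

lemma fderiv_inversion_apply (hc : 0 < c) {x : Euc N} (hx : x ≠ 0) (h : Euc N) :
    fderiv ℝ (inversion c 0) x h =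
      (c / ‖x‖ ^ 2) • h - (2 * inner ℝ x h / ‖x‖ ^ 2) • inversion c 0 x := by
  rw [(hasFDerivAt_inversion hc hx).fderiv, inversion_zero]
  simp only [smul_apply, ContinuousLinearEquiv.coe_coe,
    LinearIsometryEquiv.coe_toContinuousLinearEquiv, Submodule.reflection_orthogonal_apply,
    Submodule.reflection_singleton_apply, RCLike.ofReal_real_eq_id, id_eq]
  module

lemma contDiffAt_inversion (hc : 0 < c) {x : Euc N} (hx : x ≠ 0) :
    ContDiffAt ℝ ∞ (inversion c 0 : Euc N → Euc N) x := by
  rw [inversion_eq_euclideanGeometry hc]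
  exact ContDiffAt.inversion (n := ⊤) contDiffAt_const contDiffAt_const contDiffAt_id hx

/-- The derivative is a reflection times a conformal factor. A reflection has determinant `±1`, so
only the factor survives. -/
lemma abs_det_inversion (hc : 0 < c) (x : Euc N) :
    |((c / ‖x‖ ^ 2) • ((ℝ ∙ x)ᗮ.reflection : Euc N →L[ℝ] Euc N)).det| = (c / ‖x‖ ^ 2) ^ N := by
  rw [ContinuousLinearMap.det]
  have h1 : (((c / ‖x‖ ^ 2) • ((ℝ ∙ x)ᗮ.reflection : Euc N →L[ℝ] Euc N) : Euc N →L[ℝ] Euc N) :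
      Euc N →ₗ[ℝ] Euc N) = (c / ‖x‖ ^ 2) • ((ℝ ∙ x)ᗮ.reflection.toLinearEquiv : Euc N →ₗ[ℝ] Euc N) :=
    rfl
  rw [h1, LinearMap.det_smul, Submodule.det_reflection, abs_mul, abs_pow, abs_pow, abs_neg, abs_one,
    one_pow, mul_one, abs_of_nonneg (by positivity), finrank_euclideanSpace, Fintype.card_fin]

lemma image_inversion_compl_zero (hc : 0 < c) :
    inversion c 0 '' ({0}ᶜ : Set (Euc N)) = {0}ᶜ := by
  ext y
  constructor
  · rintro ⟨x, hx, rfl⟩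
    exact fun h => hx ((inversion_eq_zero hc).1 h)
  · intro hy
    exact ⟨inversion c 0 y, fun h => hy ((inversion_eq_zero hc).1 h), inversion_inversion hc y⟩

lemma inversion_injective (hc : 0 < c) : Function.Injective (inversion c 0 : Euc N → Euc N) :=
  Function.LeftInverse.injective (inversion_inversion hc)

variable {F : Type*} [NormedAddCommGroup F] [NormedSpace ℝ F]

lemma ae_ne_zero [NeZero N] : ∀ᵐ y : Euc N, y ≠ 0 := by
  rw [ae_iff]
  simp

lemma restrict_compl_zero [NeZero N] :
    (volume : Measure (Euc N)).restrict {0}ᶜ = volume :=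
  Measure.restrict_eq_self_of_ae_mem ae_ne_zero

/-- Change of variables under the point inversion. -/
lemma integral_comp_inversion [NeZero N] (hc : 0 < c) (f : Euc N → F) :
    ∫ x, (c / ‖x‖ ^ 2) ^ N • f (inversion c 0 x) = ∫ x, f x := by
  have := integral_image_eq_integral_abs_det_fderiv_smul (volume : Measure (Euc N))
    (s := {0}ᶜ) (measurableSet_singleton _).compl
    (fun x hx => (hasFDerivAt_inversion hc hx).hasFDerivWithinAt)
    (inversion_injective hc).injOn f
  simp_rw [abs_det_inversion hc] at this
  rwa [image_inversion_compl_zero hc, restrict_compl_zero, eq_comm] at this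

lemma integrable_comp_inversion_iff [NeZero N] (hc : 0 < c) (f : Euc N → F) :
    Integrable (fun x => (c / ‖x‖ ^ 2) ^ N • f (inversion c 0 x)) ↔ Integrable f := by
  have := integrableOn_image_iff_integrableOn_abs_det_fderiv_smul (volume : Measure (Euc N))
    (s := {0}ᶜ) (measurableSet_singleton _).compl
    (fun x hx => (hasFDerivAt_inversion hc hx).hasFDerivWithinAt)
    (inversion_injective hc).injOn f
  simp_rw [abs_det_inversion hc] at this
  rwa [image_inversion_compl_zero hc, IntegrableOn, IntegrableOn, restrict_compl_zero,
    Iff.comm] at this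

/-! ### Test functions on the punctured space -/

lemma IsTestFunction.eventuallyEq_zero {U : Set (Euc N)} {u : Euc N → ℝ}
    (hu : IsTestFunction U u) {x : Euc N} (hx : x ∉ U) : u =ᶠ[nhds x] 0 :=
  notMem_tsupport_iff_eventuallyEq.1 fun h => hx (hu.2.2 h)

lemma IsTestFunction.eq_zero {U : Set (Euc N)} {u : Euc N → ℝ}
    (hu : IsTestFunction U u) {x : Euc N} (hx : x ∉ U) : u x = 0 :=
  (hu.eventuallyEq_zero hx).eq_of_nhds

lemma IsTestFunction.mono {U V : Set (Euc N)} {u : Euc N → ℝ}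
    (hu : IsTestFunction U u) (h : U ⊆ V) : IsTestFunction V u :=
  ⟨hu.1, hu.2.1, hu.2.2.trans h⟩

/-- A product of a test function on `U` with a function that is smooth on `U`. -/
lemma IsTestFunction.mul_left {U : Set (Euc N)} {u ρ : Euc N → ℝ}
    (hu : IsTestFunction U u) (hρ : ∀ x ∈ U, ContDiffAt ℝ ∞ ρ x) :
    IsTestFunction U (fun x => ρ x * u x) := by
  refine ⟨contDiff_iff_contDiffAt.2 fun x => ?_, hu.2.1.mul_left,
    (tsupport_mul_subset_right (f := ρ) (g := u)).trans hu.2.2⟩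
  by_cases hx : x ∈ U
  · exact (hρ x hx).mul hu.1.contDiffAt
  · have : (fun x => ρ x * u x) =ᶠ[nhds x] fun _ => 0 := by
      filter_upwards [hu.eventuallyEq_zero hx] with y hy
      simp [hy]
    exact contDiffAt_const.congr_of_eventuallyEq this

lemma contDiffAt_norm_rpow (a : ℝ) {x : Euc N} (hx : x ≠ 0) :
    ContDiffAt ℝ ∞ (fun x : Euc N => ‖x‖ ^ a) x :=
  (contDiffAt_norm ℝ hx).rpow_const_of_ne (norm_ne_zero_iff.2 hx)

lemma IsTestFunction.norm_rpow_mul {U : Set (Euc N)} (hU : U ⊆ {0}ᶜ) {u : Euc N → ℝ}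
    (hu : IsTestFunction U u) (a : ℝ) : IsTestFunction U (fun x => ‖x‖ ^ a * u x) :=
  hu.mul_left fun _ hx => contDiffAt_norm_rpow a (hU hx)

/-- The inversion is an involution, continuous off `0`, so the new support lies in the compact image
of the old one. That image misses `0`, hence the composition vanishes near the singularity. -/
lemma IsTestFunction.comp_inversion (hc : 0 < c) {U : Set (Euc N)} (hU : U ⊆ {0}ᶜ) {u : Euc N → ℝ}
    (hu : IsTestFunction U u) : IsTestFunction (inversion c 0 '' U) (u ∘ inversion c 0) := by
  have hK : IsCompact (inversion c 0 '' tsupport u) := by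
    refine IsCompact.image_of_continuousOn hu.2.1 fun x hx => ?_
    exact (contDiffAt_inversion hc (hU (hu.2.2 hx))).continuousAt.continuousWithinAt
  have hsub : tsupport (u ∘ inversion c 0) ⊆ inversion c 0 '' tsupport u := by
    refine closure_minimal (fun x hx => ?_) hK.isClosed
    exact ⟨inversion c 0 x, subset_tsupport _ hx, inversion_inversion hc x⟩
  refine ⟨contDiff_iff_contDiffAt.2 fun x => ?_, hK.of_isClosed_subset (isClosed_tsupport _) hsub,
    hsub.trans (Set.image_mono hu.2.2)⟩
  rcases eq_or_ne x 0 with rfl | hx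
  · have h0 : (0 : Euc N) ∉ tsupport (u ∘ inversion c 0) := by
      intro h
      obtain ⟨y, hy, hy0⟩ := hsub h
      exact hU (hu.2.2 hy) ((inversion_eq_zero hc).1 hy0)
    exact contDiffAt_const.congr_of_eventuallyEq (notMem_tsupport_iff_eventuallyEq.1 h0)
  · exact hu.1.contDiffAt.comp x (contDiffAt_inversion hc hx)

lemma kelvin_zero_eq {s : ℝ} {u : Euc N → ℝ} (hu : u 0 = 0) :
    kelvin s c 0 u = fun x => ‖x‖ ^ (2 * s - N) * u (inversion c 0 x) := by
  ext x
  by_cases hx : x = 0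
  · subst hx
    simp [kelvin, hu]
  · simp [kelvin, hx]

lemma kelvin_zero_apply {s : ℝ} {u : Euc N → ℝ} {x : Euc N} (hx : x ≠ 0) :
    kelvin s c 0 u x = ‖x‖ ^ (2 * s - N) * u (inversion c 0 x) := by
  simp [kelvin, hx]

lemma IsTestFunction.kelvin (hc : 0 < c) (s : ℝ) {U : Set (Euc N)} (hU : U ⊆ {0}ᶜ) {u : Euc N → ℝ}
    (hu : IsTestFunction U u) : IsTestFunction (inversion c 0 '' U) (kelvin s c 0 u) := by
  rw [kelvin_zero_eq (hu.eq_zero fun h => hU h rfl)]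
  refine (hu.comp_inversion hc hU).norm_rpow_mul ?_ (2 * s - N)
  exact (Set.image_mono hU).trans (image_inversion_compl_zero hc).subset

/-! ### Partial derivatives and the Euler operator -/

/-- The `i`-th partial derivative. -/
def pd (i : Fin N) (f : Euc N → ℝ) (x : Euc N) : ℝ := fderiv ℝ f x (EuclideanSpace.single i 1)

/-- The Euler operator `∑ i, x i * ∂ᵢ f`. -/
def euler (f : Euc N → ℝ) (x : Euc N) : ℝ := fderiv ℝ f x x

lemma euler_eq_sum (f : Euc N → ℝ) (x : Euc N) : euler f x = ∑ i, x i * pd i f x := by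
  have hx : x = ∑ i, x i • EuclideanSpace.single i (1 : ℝ) := by
    simpa using ((EuclideanSpace.basisFun (Fin N) ℝ).sum_repr x).symm
  conv_lhs => rw [euler]; arg 2; rw [hx]
  simp [pd]

lemma contDiff_pd {f : Euc N → ℝ} (hf : ContDiff ℝ ∞ f) (i : Fin N) : ContDiff ℝ ∞ (pd i f) :=
  (hf.fderiv_right (by simp)).clm_apply contDiff_const

lemma contDiff_euler {f : Euc N → ℝ} (hf : ContDiff ℝ ∞ f) : ContDiff ℝ ∞ (euler f) :=
  (hf.fderiv_right (by simp)).clm_apply contDiff_id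

lemma laplacian_eq_sum_pd {f : Euc N → ℝ} (hf : ContDiff ℝ ∞ f) (x : Euc N) :
    Δ f x = ∑ i, pd i (pd i f) x := by
  rw [InnerProductSpace.laplacian_eq_iteratedFDeriv_orthonormalBasis f
    (EuclideanSpace.basisFun (Fin N) ℝ)]
  refine Finset.sum_congr rfl fun i _ => ?_
  have hd : DifferentiableAt ℝ (fderiv ℝ f) x :=
    (hf.fderiv_right (m := 1) (by norm_cast)).differentiable one_ne_zero x
  rw [iteratedFDeriv_two_apply]
  unfold pd
  rw [fderiv_clm_apply hd (differentiableAt_const _)]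
  simp

lemma pd_add {f g : Euc N → ℝ} (hf : ContDiff ℝ ∞ f) (hg : ContDiff ℝ ∞ g) (i : Fin N)
    (x : Euc N) : pd i (fun x => f x + g x) x = pd i f x + pd i g x := by
  unfold pd
  rw [fderiv_fun_add (hf.differentiable (by simp) x) (hg.differentiable (by simp) x)]
  simp

lemma pd_const_mul {f : Euc N → ℝ} (hf : ContDiff ℝ ∞ f) (a : ℝ) (i : Fin N)
    (x : Euc N) : pd i (fun x => a * f x) x = a * pd i f x := by
  unfold pd
  rw [fderiv_const_mul (hf.differentiable (by simp) x)]
  simp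

lemma contDiff_coord (i : Fin N) : ContDiff ℝ ∞ (fun x : Euc N => x i) :=
  (EuclideanSpace.proj (𝕜 := ℝ) i : Euc N →L[ℝ] ℝ).contDiff

lemma pd_coord_mul {f : Euc N → ℝ} (hf : ContDiff ℝ ∞ f) (i : Fin N) (x : Euc N) :
    pd i (fun x => x i * f x) x = f x + x i * pd i f x := by
  unfold pd
  have hp : HasFDerivAt (fun x : Euc N => x i) (EuclideanSpace.proj (𝕜 := ℝ) i) x :=
    (EuclideanSpace.proj (𝕜 := ℝ) i : Euc N →L[ℝ] ℝ).hasFDerivAt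
  rw [(hp.fun_mul (hf.differentiable (by simp) x).hasFDerivAt).fderiv]
  simp [add_comm]

lemma pd_euler {f : Euc N → ℝ} (hf : ContDiff ℝ ∞ f) (i : Fin N) (x : Euc N) :
    pd i (euler f) x = pd i f x + euler (pd i f) x := by
  have hd : DifferentiableAt ℝ (fderiv ℝ f) x :=
    (hf.fderiv_right (m := 1) (by norm_cast)).differentiable one_ne_zero x
  have hsymm := (hf.contDiffAt (x := x)).isSymmSndFDerivAt
    (by simp; norm_cast)
  unfold pd euler
  rw [fderiv_clm_apply hd differentiableAt_fun_id, fderiv_clm_apply hd (differentiableAt_const _)]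
  simpa using hsymm _ _

lemma euler_const_mul {f : Euc N → ℝ} (hf : ContDiff ℝ ∞ f) (a : ℝ)
    (x : Euc N) : euler (fun x => a * f x) x = a * euler f x := by
  unfold euler
  rw [fderiv_const_mul (hf.differentiable (by simp) x)]
  simp

lemma euler_sum {ι : Type*} (t : Finset ι) {f : ι → Euc N → ℝ} (hf : ∀ i, ContDiff ℝ ∞ (f i))
    (x : Euc N) : euler (fun x => ∑ i ∈ t, f i x) x = ∑ i ∈ t, euler (f i) x := by
  unfold euler
  rw [fderiv_fun_sum fun i _ => (hf i).differentiable (by simp) x]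
  simp

lemma euler_euler {f : Euc N → ℝ} (hf : ContDiff ℝ ∞ f) (x : Euc N) :
    euler (euler f) x = ∑ i, x i * euler (pd i f) x + euler f x := by
  rw [euler_eq_sum (euler f), euler_eq_sum f, ← Finset.sum_add_distrib]
  refine Finset.sum_congr rfl fun i _ => ?_
  rw [pd_euler hf]
  ring

/-- The Laplacian is homogeneous of degree `-2`, which makes its commutator with the Euler operator
equal to `2Δ`. -/
lemma laplacian_euler {f : Euc N → ℝ} (hf : ContDiff ℝ ∞ f) (x : Euc N) :
    Δ (euler f) x = euler (Δ f) x + 2 * Δ f x := by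
  rw [laplacian_eq_sum_pd (contDiff_euler hf), funext (laplacian_eq_sum_pd hf),
    euler_sum _ fun i => contDiff_pd (contDiff_pd hf i) i, Finset.mul_sum, ← Finset.sum_add_distrib]
  refine Finset.sum_congr rfl fun i _ => ?_
  have hi := contDiff_pd hf i
  rw [funext (pd_euler hf i), pd_add hi (contDiff_euler hi), pd_euler hi]
  ring

lemma laplacian_add {f g : Euc N → ℝ} (hf : ContDiff ℝ ∞ f) (hg : ContDiff ℝ ∞ g)
    (x : Euc N) : Δ (fun x => f x + g x) x = Δ f x + Δ g x :=
  ContDiffAt.laplacian_add (hf.of_le (by norm_cast)).contDiffAt (hg.of_le (by norm_cast)).contDiffAt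

lemma laplacian_const_mul {f : Euc N → ℝ} (hf : ContDiff ℝ ∞ f) (a : ℝ)
    (x : Euc N) : Δ (fun x => a * f x) x = a * Δ f x :=
  InnerProductSpace.laplacian_smul a (hf.of_le (by norm_cast)).contDiffAt

/-! ### Differentiating test functions on the punctured space -/

lemma tsupport_clm_apply_fderiv_subset (f : Euc N → ℝ) (h : Euc N → Euc N) :
    tsupport (fun x => fderiv ℝ f x (h x)) ⊆ tsupport f := by
  refine closure_minimal (fun x hx => ?_) (isClosed_tsupport f)
  refine support_fderiv_subset ℝ (f := f) fun h0 => hx ?_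
  simp [h0]

lemma IsTestFunction.pd {U : Set (Euc N)} {f : Euc N → ℝ} (hf : IsTestFunction U f) (i : Fin N) :
    IsTestFunction U (pd i f) := by
  have h := tsupport_clm_apply_fderiv_subset f fun _ => EuclideanSpace.single i 1
  exact ⟨contDiff_pd hf.1 i, hf.2.1.of_isClosed_subset (isClosed_tsupport _) h, h.trans hf.2.2⟩

lemma IsTestFunction.euler {U : Set (Euc N)} {f : Euc N → ℝ} (hf : IsTestFunction U f) :
    IsTestFunction U (euler f) := by
  have h := tsupport_clm_apply_fderiv_subset f fun x => x
  exact ⟨contDiff_euler hf.1, hf.2.1.of_isClosed_subset (isClosed_tsupport _) h, h.trans hf.2.2⟩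

lemma IsTestFunction.add {U : Set (Euc N)} {f g : Euc N → ℝ} (hf : IsTestFunction U f)
    (hg : IsTestFunction U g) : IsTestFunction U (fun x => f x + g x) :=
  ⟨hf.1.add hg.1, hf.2.1.add hg.2.1,
    (tsupport_add f g).trans (Set.union_subset hf.2.2 hg.2.2)⟩

lemma IsTestFunction.sum {ι : Type*} {U : Set (Euc N)} (t : Finset ι) {f : ι → Euc N → ℝ}
    (hf : ∀ i, IsTestFunction U (f i)) : IsTestFunction U (fun x => ∑ i ∈ t, f i x) := by
  classical
  induction t using Finset.induction_on with
  | empty =>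
    refine ⟨by simpa using contDiff_const, ?_, ?_⟩
    · exact HasCompactSupport.zero
    · simp [tsupport]
  | insert i t hi ih => simpa [Finset.sum_insert hi] using (hf i).add ih

lemma IsTestFunction.laplacian {U : Set (Euc N)} {f : Euc N → ℝ} (hf : IsTestFunction U f) :
    IsTestFunction U (Δ f) := by
  rw [funext (laplacian_eq_sum_pd hf.1)]
  exact IsTestFunction.sum _ fun i => (hf.pd i).pd i

lemma IsTestFunction.const_mul {U : Set (Euc N)} {f : Euc N → ℝ} (hf : IsTestFunction U f)
    (a : ℝ) : IsTestFunction U (fun x => a * f x) :=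
  hf.mul_left fun _ _ => contDiffAt_const

lemma IsTestFunction.coord_mul {U : Set (Euc N)} {f : Euc N → ℝ} (hf : IsTestFunction U f)
    (i : Fin N) : IsTestFunction U (fun x => x i * f x) :=
  hf.mul_left fun _ _ => (contDiff_coord i).contDiffAt

lemma IsTestFunction.laplacian_iterate {U : Set (Euc N)} {f : Euc N → ℝ} (hf : IsTestFunction U f)
    (m : ℕ) : IsTestFunction U (Δ^[m] f) := by
  induction m with
  | zero => exact hf
  | succ m ih =>
    rw [Function.iterate_succ_apply']
    exact ih.laplacian

/-- At the origin both sides vanish because `f` is zero nearby. Having the product rule at every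
point allows rewriting it as an equality of functions and differentiating again. -/
lemma fderiv_norm_rpow_mul {f : Euc N → ℝ} (hf : IsTestFunction {0}ᶜ f) (a : ℝ) (x h : Euc N) :
    fderiv ℝ (fun x => ‖x‖ ^ a * f x) x h =
      a * (‖x‖ ^ (a - 2) * (inner ℝ x h * f x)) + ‖x‖ ^ a * fderiv ℝ f x h := by
  rcases eq_or_ne x 0 with rfl | hx
  · have h0 := (hf.norm_rpow_mul subset_rfl a).eventuallyEq_zero (x := 0) (by simp)
    have h1 := hf.eventuallyEq_zero (x := 0) (by simp)
    rw [h0.fderiv_eq, h1.fderiv_eq, h1.eq_of_nhds]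
    simp
  · have hn : ‖x‖ ≠ 0 := norm_ne_zero_iff.2 hx
    have h2 : HasFDerivAt (fun x : Euc N => ‖x‖ ^ a) ((a * ‖x‖ ^ (a - 2)) • innerSL ℝ x) x := by
      have h3 := (hasStrictFDerivAt_norm_sq x).hasFDerivAt.rpow_const (p := a / 2)
        (Or.inl (by positivity))
      have h4 : (fun x : Euc N => (‖x‖ ^ 2) ^ (a / 2)) = fun x => ‖x‖ ^ a := by
        ext y
        rw [← Real.rpow_natCast, ← Real.rpow_mul (norm_nonneg _)]
        congr 1
        push_cast
        ring
      rw [h4] at h3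
      refine h3.congr_fderiv ?_
      rw [← Real.rpow_natCast ‖x‖ 2, ← Real.rpow_mul (norm_nonneg _)]
      ext y
      simp only [smul_apply, smul_eq_mul, nsmul_eq_mul]
      push_cast
      rw [show (2 : ℝ) * (a / 2 - 1) = a - 2 by ring]
      ring
    rw [(h2.fun_mul (hf.1.differentiable (by simp) x).hasFDerivAt).fderiv]
    simp
    ring

lemma pd_norm_rpow_mul {f : Euc N → ℝ} (hf : IsTestFunction {0}ᶜ f) (a : ℝ) (i : Fin N)
    (x : Euc N) : pd i (fun x => ‖x‖ ^ a * f x) x =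
      a * (‖x‖ ^ (a - 2) * (x i * f x)) + ‖x‖ ^ a * pd i f x := by
  unfold pd
  rw [fderiv_norm_rpow_mul hf]
  simp [EuclideanSpace.inner_single_right]

lemma norm_rpow_sub_two_mul {x : Euc N} (hx : x ≠ 0) (a : ℝ) :
    ‖x‖ ^ (a - 2) * ‖x‖ ^ 2 = ‖x‖ ^ a := by
  rw [← Real.rpow_natCast, ← Real.rpow_add (norm_pos_iff.2 hx)]
  simp

lemma euler_norm_rpow_mul {f : Euc N → ℝ} (hf : IsTestFunction {0}ᶜ f) (a : ℝ)
    (x : Euc N) : euler (fun x => ‖x‖ ^ a * f x) x = a * (‖x‖ ^ a * f x) + ‖x‖ ^ a * euler f x := by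
  unfold euler
  rw [fderiv_norm_rpow_mul hf]
  rcases eq_or_ne x 0 with rfl | hx
  · simp [hf.eq_zero (x := 0) (by simp)]
  · rw [real_inner_self_eq_norm_sq, ← norm_rpow_sub_two_mul hx a]
    ring

lemma sum_coord_sq (x : Euc N) : ∑ i, x i * x i = ‖x‖ ^ 2 := by
  rw [EuclideanSpace.norm_sq_eq]
  simp [sq]

lemma laplacian_norm_rpow_mul {f : Euc N → ℝ} (hf : IsTestFunction {0}ᶜ f) (a : ℝ) (x : Euc N) :
    Δ (fun x => ‖x‖ ^ a * f x) x = ‖x‖ ^ a * Δ f x + 2 * a * (‖x‖ ^ (a - 2) * euler f x) +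
      a * (a + N - 2) * (‖x‖ ^ (a - 2) * f x) := by
  rw [laplacian_eq_sum_pd (hf.norm_rpow_mul subset_rfl a).1, laplacian_eq_sum_pd hf.1]
  have key : ∀ i, pd i (pd i (fun x => ‖x‖ ^ a * f x)) x =
      a * (a - 2) * ‖x‖ ^ (a - 4) * f x * (x i * x i) + a * ‖x‖ ^ (a - 2) * f x
        + 2 * a * ‖x‖ ^ (a - 2) * (x i * pd i f x) + ‖x‖ ^ a * pd i (pd i f) x := by
    intro i
    have h1 := (hf.coord_mul i).norm_rpow_mul subset_rfl (a - 2)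
    have h2 := (hf.pd i).norm_rpow_mul subset_rfl a
    rw [funext (pd_norm_rpow_mul hf a i), pd_add (h1.const_mul a).1 h2.1, pd_const_mul h1.1,
      pd_norm_rpow_mul (hf.coord_mul i), pd_norm_rpow_mul (hf.pd i), pd_coord_mul hf.1,
      show a - 2 - 2 = a - 4 by ring]
    ring
  simp_rw [key, Finset.sum_add_distrib, ← Finset.mul_sum, sum_coord_sq, ← euler_eq_sum]
  rcases eq_or_ne x 0 with rfl | hx
  · simp [hf.eq_zero (x := 0) (by simp), hf.euler.eq_zero (x := 0) (by simp)]
  · have := norm_rpow_sub_two_mul hx (a - 2)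
    rw [show a - 2 - 2 = a - 4 by ring] at this
    simp only [Finset.sum_const, Finset.card_univ, Fintype.card_fin, nsmul_eq_mul]
    rw [← this]
    ring

lemma laplacian_norm_sq_mul {f : Euc N → ℝ} (hf : IsTestFunction {0}ᶜ f) (x : Euc N) :
    Δ (fun x => ‖x‖ ^ (2 : ℝ) * f x) x =
      ‖x‖ ^ (2 : ℝ) * Δ f x + 4 * euler f x + 2 * N * f x := by
  rw [laplacian_norm_rpow_mul hf]
  norm_num

/-- The commutator of `Δ^(m+1)` and multiplication with `‖x‖²`. -/
lemma laplacian_iterate_norm_sq_mul {f : Euc N → ℝ} (hf : IsTestFunction {0}ᶜ f) (m : ℕ)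
    (x : Euc N) : Δ^[m + 1] (fun x => ‖x‖ ^ (2 : ℝ) * f x) x =
      ‖x‖ ^ (2 : ℝ) * Δ^[m + 1] f x +
        (4 * (m + 1) * euler (Δ^[m] f) x + (m + 1) * (2 * N + 4 * m) * Δ^[m] f x) := by
  induction m generalizing x with
  | zero =>
    simp only [zero_add, Function.iterate_one, Function.iterate_zero, id]
    rw [laplacian_norm_sq_mul hf]
    push_cast
    ring
  | succ m ih =>
    have h0 := hf.laplacian_iterate m
    have h1 := hf.laplacian_iterate (m + 1)
    rw [Function.iterate_succ_apply', funext ih,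
      laplacian_add (h1.norm_rpow_mul subset_rfl 2).1
        ((h0.euler.const_mul _).add (h0.const_mul _)).1,
      laplacian_add (h0.euler.const_mul _).1 (h0.const_mul _).1, laplacian_const_mul h0.euler.1,
      laplacian_const_mul h0.1, laplacian_norm_sq_mul h1, laplacian_euler h0.1,
      Function.iterate_succ_apply' _ (m + 1), Function.iterate_succ_apply' _ m]
    push_cast
    ring

/-! ### Differential operators and the point inversion -/

lemma IsTestFunction.comp_inversion_compl (hc : 0 < c) {f : Euc N → ℝ}
    (hf : IsTestFunction {0}ᶜ f) : IsTestFunction {0}ᶜ (fun x => f (inversion c 0 x)) :=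
  (hf.comp_inversion hc subset_rfl).mono (image_inversion_compl_zero hc).subset

lemma fderiv_comp_inversion (hc : 0 < c) {f : Euc N → ℝ} (hf : IsTestFunction {0}ᶜ f)
    {x : Euc N} (hx : x ≠ 0) (h : Euc N) : fderiv ℝ (fun x => f (inversion c 0 x)) x h =
      (c / ‖x‖ ^ 2) * fderiv ℝ f (inversion c 0 x) h
        - (2 * inner ℝ x h / ‖x‖ ^ 2) * euler f (inversion c 0 x) := by
  have h1 : DifferentiableAt ℝ f (inversion c 0 x) := hf.1.differentiable (by simp) _
  have h2 := (hasFDerivAt_inversion hc hx).differentiableAt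
  have h3 : fderiv ℝ (fun x => f (inversion c 0 x)) x =
      (fderiv ℝ f (inversion c 0 x)).comp (fderiv ℝ (inversion c 0) x) := fderiv_comp x h1 h2
  rw [h3, ContinuousLinearMap.comp_apply, fderiv_inversion_apply hc hx]
  simp [euler]

/-- On each ray the inversion sends `r` to `c/r`, that is, it reverses `log r`, whose derivative is
the Euler operator. -/
lemma euler_comp_inversion (hc : 0 < c) {f : Euc N → ℝ} (hf : IsTestFunction {0}ᶜ f)
    (x : Euc N) : euler (fun x => f (inversion c 0 x)) x = - euler f (inversion c 0 x) := by
  rcases eq_or_ne x 0 with rfl | hx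
  · simp [euler]
  · have hn : ‖x‖ ≠ 0 := norm_ne_zero_iff.2 hx
    rw [euler, fderiv_comp_inversion hc hf hx, real_inner_self_eq_norm_sq]
    have : c / ‖x‖ ^ 2 * fderiv ℝ f (inversion c 0 x) x = euler f (inversion c 0 x) := by
      rw [euler, inversion_zero, map_smul, smul_eq_mul]
    rw [this]
    field_simp
    ring

lemma pd_comp_inversion (hc : 0 < c) {f : Euc N → ℝ} (hf : IsTestFunction {0}ᶜ f) (i : Fin N)
    (x : Euc N) : pd i (fun x => f (inversion c 0 x)) x = ‖x‖ ^ (-2 : ℝ) *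
      (c * pd i f (inversion c 0 x) + (-2) * (x i * euler f (inversion c 0 x))) := by
  rcases eq_or_ne x 0 with rfl | hx
  · rw [((hf.comp_inversion_compl hc).pd i).eq_zero (by simp), inversion_zero_zero,
      (hf.pd i).eq_zero (by simp)]
    simp
  · rw [pd, fderiv_comp_inversion hc hf hx, pd, Real.rpow_neg (norm_nonneg _),
      EuclideanSpace.inner_single_right, Real.rpow_two]
    simp only [conj_trivial]
    ring

lemma sum_coord_mul_inversion {x : Euc N} (hx : x ≠ 0) (g : Fin N → ℝ) :
    c * ∑ i, x i * g i = ‖x‖ ^ 2 * ∑ i, inversion c 0 x i * g i := by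
  have hn : ‖x‖ ≠ 0 := norm_ne_zero_iff.2 hx
  rw [Finset.mul_sum, Finset.mul_sum]
  refine Finset.sum_congr rfl fun i _ => ?_
  rw [inversion_zero]
  simp only [PiLp.smul_apply, smul_eq_mul]
  field_simp

/-- Conformality makes the second-order part a multiple of `Δ`; the first-order term is the
Laplacian of the inversion itself, absent when `N = 2`. -/
lemma laplacian_comp_inversion (hc : 0 < c) {f : Euc N → ℝ} (hf : IsTestFunction {0}ᶜ f)
    {x : Euc N} (hx : x ≠ 0) : Δ (fun x => f (inversion c 0 x)) x =
      c ^ 2 * (‖x‖ ^ 4)⁻¹ * Δ f (inversion c 0 x)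
        + (4 - 2 * N) * (‖x‖ ^ 2)⁻¹ * euler f (inversion c 0 x) := by
  have hn : ‖x‖ ≠ 0 := norm_ne_zero_iff.2 hx
  have r2 : ‖x‖ ^ (-2 : ℝ) = (‖x‖ ^ 2)⁻¹ := by
    rw [Real.rpow_neg (norm_nonneg _), Real.rpow_two]
  have r4 : ‖x‖ ^ (-2 - 2 : ℝ) = (‖x‖ ^ 4)⁻¹ := by
    rw [show (-2 - 2 : ℝ) = -((4 : ℕ) : ℝ) by norm_num, Real.rpow_neg (norm_nonneg _),
      Real.rpow_natCast]
  rw [laplacian_eq_sum_pd (hf.comp_inversion_compl hc).1, laplacian_eq_sum_pd hf.1]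
  have key : ∀ i, pd i (pd i (fun x => f (inversion c 0 x))) x =
      (-2) * (‖x‖ ^ 4)⁻¹ * (c * (x i * pd i f (inversion c 0 x)))
      + 4 * (‖x‖ ^ 4)⁻¹ * euler f (inversion c 0 x) * (x i * x i)
      + c ^ 2 * (‖x‖ ^ 4)⁻¹ * pd i (pd i f) (inversion c 0 x)
      + (-2) * (‖x‖ ^ 4)⁻¹ * (c * (x i * euler (pd i f) (inversion c 0 x)))
      + (-2) * (‖x‖ ^ 2)⁻¹ * euler f (inversion c 0 x)
      + (-2) * (‖x‖ ^ 2)⁻¹ * (x i * pd i (fun x => euler f (inversion c 0 x)) x) := by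
    intro i
    have h1 := (hf.pd i).comp_inversion_compl hc
    have h2 := hf.euler.comp_inversion_compl hc
    rw [funext (pd_comp_inversion hc hf i),
      pd_norm_rpow_mul ((h1.const_mul c).add ((h2.coord_mul i).const_mul (-2))),
      pd_add (h1.const_mul c).1 ((h2.coord_mul i).const_mul (-2)).1, pd_const_mul h1.1,
      pd_const_mul (h2.coord_mul i).1, pd_coord_mul h2.1, pd_comp_inversion hc (hf.pd i), r2, r4]
    field_simp
    ring
  simp_rw [key, Finset.sum_add_distrib, ← Finset.mul_sum, sum_coord_sq, ← euler_eq_sum,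
    euler_comp_inversion hc hf.euler, sum_coord_mul_inversion hx, ← euler_eq_sum]
  rw [euler_euler hf.1]
  simp only [Finset.sum_const, Finset.card_univ, Fintype.card_fin, nsmul_eq_mul]
  field_simp
  ring

/-- Covariance of the polyharmonic operator under the Kelvin transform. -/
lemma laplacian_iterate_kelvin (hc : 0 < c) {u : Euc N → ℝ} (hu : IsTestFunction {0}ᶜ u) (m : ℕ)
    (x : Euc N) : Δ^[m] (fun x => ‖x‖ ^ (2 * m - N : ℝ) * u (inversion c 0 x)) x =
      c ^ (2 * m) * (‖x‖ ^ (-2 * m - N : ℝ) * Δ^[m] u (inversion c 0 x)) := by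
  induction m generalizing x with
  | zero => simp
  | succ m ih =>
    have hw := hu.laplacian_iterate m
    have hG := hw.comp_inversion_compl hc
    have hg := (hu.comp_inversion_compl hc).norm_rpow_mul subset_rfl (2 * m - N)
    rcases eq_or_ne x 0 with rfl | hx
    · rw [inversion_zero_zero, (hu.laplacian_iterate (m + 1)).eq_zero (by simp),
        (((hu.comp_inversion_compl hc).norm_rpow_mul subset_rfl _).laplacian_iterate
          (m + 1)).eq_zero (by simp)]
      simp
    have hn : 0 < ‖x‖ := norm_pos_iff.2 hx
    have h1 : (fun x : Euc N => ‖x‖ ^ (2 * (m + 1 : ℕ) - N : ℝ) * u (inversion c 0 x)) =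
        fun x => ‖x‖ ^ (2 : ℝ) * (‖x‖ ^ (2 * m - N : ℝ) * u (inversion c 0 x)) := by
      ext y
      rcases eq_or_ne y 0 with rfl | hy
      · simp [hu.eq_zero (x := 0) (by simp)]
      · rw [← mul_assoc, ← Real.rpow_add (norm_pos_iff.2 hy)]
        congr 2
        push_cast
        ring
    have hG' := hG.norm_rpow_mul subset_rfl (-2 * m - N : ℝ)
    -- With `w = Δ^m u`, all terms become multiples of `Δ w`, `euler w` and `w` at the inverted
    -- point. The exponent `-2m-N` makes the last two coefficients cancel.
    rw [h1, laplacian_iterate_norm_sq_mul hg, Function.iterate_succ_apply', funext ih,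
      laplacian_const_mul hG'.1, euler_const_mul hG'.1, laplacian_norm_rpow_mul hG,
      euler_norm_rpow_mul hG, laplacian_comp_inversion hc hw hx, euler_comp_inversion hc hw,
      Function.iterate_succ_apply']
    beta_reduce
    rw [← norm_rpow_sub_two_mul hx (-2 * m - N : ℝ),
      show (-2 * (m + 1 : ℕ) - N : ℝ) = -2 * m - N - 2 by push_cast; ring, Real.rpow_two]
    field_simp
    ring

lemma neg_laplacian_iterate {u : Euc N → ℝ} {U : Set (Euc N)} (hu : IsTestFunction U u) (m : ℕ)
    (x : Euc N) : (fun w : Euc N → ℝ => -(Δ w))^[m] u x = (-1) ^ m * Δ^[m] u x := by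
  induction m generalizing x with
  | zero => simp
  | succ m ih =>
    rw [Function.iterate_succ_apply', funext ih, Function.iterate_succ_apply', Pi.neg_apply,
      laplacian_const_mul (hu.laplacian_iterate m).1]
    ring

/-! ### Finite differences -/

/-- The weights of the centered finite difference of order `2m+2`. -/
def wt (m : ℕ) (k : ℤ) : ℝ := (-1 : ℝ) ^ k * ((2 * m + 2).choose ((m : ℤ) + 1 - k).toNat : ℝ)

lemma finiteDiff_eq (m : ℕ) (u : Euc N → ℝ) (x y : Euc N) :
    finiteDiff m u x y = ∑ k ∈ Finset.Icc (-((m : ℤ) + 1)) ((m : ℤ) + 1),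
      wt m k * u (x + (k : ℝ) • y) := rfl

/-- The shift `j = k + (m+1)` turns the centered difference into an iterated forward difference,
which kills constants and is controlled by derivatives. -/
lemma sum_wt_smul_eq_fwdDiff {F : Type*} [AddCommGroup F] [Module ℝ F] (m : ℕ) (f : ℝ → F) :
    ∑ k ∈ Finset.Icc (-((m : ℤ) + 1)) ((m : ℤ) + 1), wt m k • f k =
      (-1 : ℝ) ^ (m + 1) • (fwdDiff 1)^[2 * m + 2] f (-(m + 1)) := by
  rw [fwdDiff_iter_eq_sum_shift, Finset.smul_sum]
  symm
  refine Finset.sum_bij' (fun j _ => (j : ℤ) - (m + 1)) (fun k _ => (k + (m + 1)).toNat)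
    ?_ ?_ ?_ ?_ ?_
  · intro j hj
    simp only [Finset.mem_range, Finset.mem_Icc] at hj ⊢
    omega
  · intro k hk
    simp only [Finset.mem_range, Finset.mem_Icc] at hk ⊢
    omega
  · intro j hj
    simp
  · intro k hk
    simp only [Finset.mem_Icc] at hk
    omega
  · intro j hj
    simp only [Finset.mem_range] at hj
    have hj' : j ≤ 2 * m + 2 := by omega
    have e1 : ((m : ℤ) + 1 - ((j : ℤ) - (m + 1))).toNat = 2 * m + 2 - j := by omega
    have e2 : (-(m + 1) : ℝ) + j • (1 : ℝ) = (((j : ℤ) - (m + 1) : ℤ) : ℝ) := by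
      push_cast
      simp only [nsmul_eq_mul]
      ring
    rw [wt, e1, e2, Nat.choose_symm hj', ← Int.cast_smul_eq_zsmul ℝ, smul_smul]
    congr 1
    push_cast
    rw [← mul_assoc]
    congr 1
    have h1 : ((-1 : ℝ) ^ (2 * m + 2 - j)) = (-1) ^ j := by
      rw [neg_one_pow_eq_pow_mod_two, neg_one_pow_eq_pow_mod_two (n := j)]
      congr 1
      omega
    rw [h1, zpow_sub₀ (by norm_num), zpow_natCast, div_eq_mul_inv, mul_comm]
    congr 1
    rw [← zpow_neg_one, ← zpow_mul, ← zpow_natCast]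
    push_cast
    rcases Int.even_or_odd ((m : ℤ) + 1) with h | h
    · rw [h.neg_one_zpow, Even.neg_one_zpow (h.mul_right _)]
    · rw [h.neg_one_zpow, Odd.neg_one_zpow (h.mul (by decide))]

lemma sum_wt (m : ℕ) : ∑ k ∈ Finset.Icc (-((m : ℤ) + 1)) ((m : ℤ) + 1), wt m k = 0 := by
  have := sum_wt_smul_eq_fwdDiff (F := ℝ) m (fun _ => 1)
  simp only [smul_eq_mul, mul_one] at this
  rw [this, Function.iterate_succ_apply, fwdDiff_const, Function.iterate_fixed]
  · simp
  · exact fwdDiff_const (1 : ℝ) (0 : ℝ)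

lemma natCast_le_infty (n : ℕ) : (n : WithTop ℕ∞) ≤ ∞ := by
  exact_mod_cast le_top

/-- Each unit difference costs one derivative by the mean value inequality. -/
lemma norm_fwdDiff_iterate_le (n : ℕ) {f : ℝ → F} (hf : ContDiff ℝ ∞ f) {C : ℝ}
    (hC : ∀ t, ‖iteratedDeriv n f t‖ ≤ C) (t : ℝ) : ‖(fwdDiff 1)^[n] f t‖ ≤ C := by
  induction n generalizing f t with
  | zero => simpa using hC t
  | succ n ih =>
    rw [Function.iterate_succ_apply]
    have hsh : ContDiff ℝ ∞ (fun t => f (t + 1)) := hf.comp (contDiff_id.add contDiff_const)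
    refine ih (f := fwdDiff 1 f) (hsh.sub hf) (fun t => ?_) t
    have h1 : iteratedDeriv n (fwdDiff 1 f) t = iteratedDeriv n f (t + 1) - iteratedDeriv n f t := by
      have := iteratedDeriv_fun_sub (n := n) (x := t) (hsh.of_le (natCast_le_infty n)).contDiffAt
        (hf.of_le (natCast_le_infty n)).contDiffAt
      rw [iteratedDeriv_comp_add_const] at this
      exact this
    rw [h1]
    have hd : Differentiable ℝ (iteratedDeriv n f) :=
      hf.differentiable_iteratedDeriv n (by exact_mod_cast WithTop.coe_lt_top n)
    simpa using Convex.norm_image_sub_le_of_norm_deriv_le (s := Set.univ) (fun x _ => hd x)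
      (fun x _ => by rw [← iteratedDeriv_succ]; exact hC x) convex_univ (Set.mem_univ t)
      (Set.mem_univ (t + 1))

/-- Restrict `G` to the line `q + t h` and apply the one-dimensional bound. A general `V` allows `ℂ
× ℝ^N`, with the complex order carried as an inert coordinate. -/
lemma norm_sum_wt_smul_le {V : Type*} [NormedAddCommGroup V] [NormedSpace ℝ V] (m : ℕ)
    {G : V → F} (hG : ContDiff ℝ ∞ G) (q h : V) {C : ℝ}
    (hC : ∀ t : ℝ, ‖iteratedFDeriv ℝ (2 * m + 2) G (q + t • h)‖ ≤ C) :
    ‖∑ k ∈ Finset.Icc (-((m : ℤ) + 1)) ((m : ℤ) + 1), wt m k • G (q + (k : ℝ) • h)‖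
      ≤ C * ‖h‖ ^ (2 * m + 2) := by
  rw [sum_wt_smul_eq_fwdDiff m (fun t => G (q + t • h)), norm_smul, norm_pow, norm_neg, norm_one,
    one_pow, one_mul]
  have hsh : ContDiff ℝ ∞ (fun p => G (q + p)) := hG.comp (contDiff_const.add contDiff_id)
  refine norm_fwdDiff_iterate_le _ (f := fun t => G (q + t • h))
    (hsh.comp (contDiff_id.smul contDiff_const)) (fun t => ?_) _
  let L : ℝ →L[ℝ] V := ContinuousLinearMap.toSpanSingleton ℝ h
  have h1 : (fun t : ℝ => G (q + t • h)) = (fun p => G (q + p)) ∘ L := by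
    ext t
    simp [L]
  have h2 := L.iteratedFDeriv_comp_right hsh t (natCast_le_infty (2 * m + 2))
  rw [← norm_iteratedFDeriv_eq_norm_iteratedDeriv, h1, h2, iteratedFDeriv_comp_add_left]
  refine (ContinuousMultilinearMap.norm_compContinuousLinearMap_le _ _).trans ?_
  simp only [Finset.prod_const, Finset.card_univ, Fintype.card_fin, L,
    ContinuousLinearMap.norm_toSpanSingleton]
  gcongr
  simpa using hC t

/-! ### Integrability of truncated powers -/

/-- In polar coordinates the integrand is `r^(p-1-t)` on `(0,1]` and `r^(-1-t)` beyond. -/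
lemma integrable_min_norm_pow_mul_rpow [NeZero N] (p : ℕ) {t : ℝ} (ht : 0 < t) (htp : t < p) :
    Integrable (fun y : Euc N => min (‖y‖ ^ p) 1 * ‖y‖ ^ (-(N + t) : ℝ)) := by
  rw [integrable_fun_norm_addHaar (volume : Measure (Euc N))
    (f := fun r => min (r ^ p) 1 * r ^ (-(N + t) : ℝ))]
  have h0 : ∀ r : ℝ, 0 < r → r ^ (Module.finrank ℝ (Euc N) - 1) * r ^ (-(N + t) : ℝ)
      = r ^ (-1 - t) := by
    intro r hr
    rw [finrank_euclideanSpace, Fintype.card_fin, ← Real.rpow_natCast, ← Real.rpow_add hr,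
      Nat.cast_sub NeZero.one_le]
    congr 1
    push_cast
    ring
  have hm : ∀ s : Set ℝ, AEStronglyMeasurable (fun r : ℝ => r ^ (Module.finrank ℝ (Euc N) - 1) •
      (min (r ^ p) 1 * r ^ (-(N + t) : ℝ))) (volume.restrict s) := by
    intro s
    refine Measurable.aestronglyMeasurable ?_
    fun_prop
  rw [← Set.Ioc_union_Ioi_eq_Ioi zero_le_one]
  refine IntegrableOn.union ?_ ?_
  · have h1 : IntegrableOn (fun r : ℝ => r ^ (p - 1 - t : ℝ)) (Set.Ioc 0 1) :=
      (intervalIntegrable_iff_integrableOn_Ioc_of_le zero_le_one).1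
        (intervalIntegral.intervalIntegrable_rpow' (by linarith))
    refine Integrable.mono' h1 (hm _) ?_
    filter_upwards [ae_restrict_mem measurableSet_Ioc] with r hr
    have hr0 : 0 < r := hr.1
    rw [smul_eq_mul, mul_left_comm, h0 r hr0, Real.norm_of_nonneg (by positivity),
      show (p - 1 - t : ℝ) = p + (-1 - t) by ring, Real.rpow_add hr0, Real.rpow_natCast]
    gcongr
    exact min_le_left _ _
  · have h1 : IntegrableOn (fun r : ℝ => r ^ (-1 - t : ℝ)) (Set.Ioi 1) :=
      integrableOn_Ioi_rpow_of_lt (by linarith) one_pos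
    refine Integrable.mono' h1 (hm _) ?_
    filter_upwards [ae_restrict_mem measurableSet_Ioi] with r hr
    have hr0 : 0 < r := zero_lt_one.trans hr
    rw [smul_eq_mul, mul_left_comm, h0 r hr0, Real.norm_of_nonneg (by positivity)]
    exact mul_le_of_le_one_left (by positivity) (min_le_right _ _)

/-! ### Holomorphic parameter integrals -/

/-- A locally dominated integral of entire functions is holomorphic. -/
lemma differentiableAt_integral_of_dominated {α : Type*} [MeasurableSpace α] {μ : Measure α}
    {f : ℂ → α → ℂ} {z₀ : ℂ} {r : ℝ} (hr : 0 < r) {b : α → ℝ}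
    (hm : ∀ z, AEStronglyMeasurable (f z) μ) (hd : ∀ a, Differentiable ℂ fun z => f z a)
    (hb : ∀ᵐ a ∂μ, ∀ z ∈ Metric.ball z₀ (2 * r), ‖f z a‖ ≤ b a) (hbi : Integrable b μ) :
    DifferentiableAt ℂ (fun z => ∫ a, f z a ∂μ) z₀ := by
  have hz₀ : z₀ ∈ Metric.ball z₀ (2 * r) := Metric.mem_ball_self (by positivity)
  refine (hasDerivAt_integral_of_dominated_loc_of_deriv_le (bound := fun a => b a / (r / 2))
    (F' := fun z a => deriv (fun z => f z a) z)
    (Metric.ball_mem_nhds z₀ hr) (.of_forall hm) ?_ ?_ ?_ (hbi.div_const _) ?_).2.differentiableAt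
  · exact hbi.mono' (hm z₀) (hb.mono fun a ha => ha z₀ hz₀)
  · refine aestronglyMeasurable_of_tendsto_ae (nhdsWithin (0 : ℂ) {0}ᶜ)
      (f := fun t a => t⁻¹ • (f (z₀ + t) a - f z₀ a)) (fun t => ?_) (.of_forall fun a => ?_)
    · exact ((hm (z₀ + t)).sub (hm z₀)).const_smul t⁻¹
    · exact ((hd a) z₀).hasDerivAt.tendsto_slope_zero
  · filter_upwards [hb] with a ha z hz
    -- Cauchy's estimate on a circle of radius `r/2`; centered in the `r`-ball, it stays inside the
    -- `2r`-ball.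
    refine Complex.norm_deriv_le_of_forall_mem_sphere_norm_le (by positivity)
      (hd a).diffContOnCl fun w hw => ha w ?_
    rw [Metric.mem_ball] at hz ⊢
    rw [Metric.mem_sphere] at hw
    linarith [dist_triangle w z z₀]
  · exact .of_forall fun a z _ => ((hd a) z).hasDerivAt

/-- The complex power `‖y‖ ^ z`, which is entire in `z`. -/
def npow (z : ℂ) (y : Euc N) : ℂ := Complex.exp (z * Real.log ‖y‖)

lemma norm_npow (z : ℂ) {y : Euc N} (hy : y ≠ 0) : ‖npow z y‖ = ‖y‖ ^ z.re := by
  rw [npow, Complex.norm_exp, Real.rpow_def_of_pos (norm_pos_iff.2 hy), Complex.re_mul_ofReal,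
    mul_comm]

lemma npow_ofReal (s : ℝ) {y : Euc N} (hy : y ≠ 0) : npow (s : ℂ) y = ((‖y‖ ^ s : ℝ) : ℂ) := by
  rw [npow, Real.rpow_def_of_pos (norm_pos_iff.2 hy), mul_comm]
  push_cast
  rfl

lemma differentiable_npow {g : ℂ → ℂ} (hg : Differentiable ℂ g) (y : Euc N) :
    Differentiable ℂ fun z => npow (g z) y :=
  (hg.mul_const _).cexp

lemma measurable_npow (z : ℂ) : Measurable (npow z : Euc N → ℂ) := by
  unfold npow
  fun_prop

/-- The (complexified) integrand of the fractional Laplacian is holomorphic in its order. -/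
lemma differentiableOn_integral_finiteDiff [NeZero N] (m : ℕ) {G : ℂ × Euc N → ℂ}
    (hG : ContDiff ℝ ∞ G) (hGz : ∀ p, Differentiable ℂ fun z => G (z, p)) {K : Set (Euc N)}
    (hK : IsCompact K) (hGK : ∀ z, ∀ p ∉ K, G (z, p) = 0) (x : Euc N) :
    DifferentiableOn ℂ (fun z => ∫ y : Euc N,
      (∑ k ∈ Finset.Icc (-((m : ℤ) + 1)) ((m : ℤ) + 1), wt m k • G (z, x + (k : ℝ) • y)) *
        npow (-(N + 2 * z)) y) {z | 0 < z.re ∧ z.re < m + 1} := by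
  rintro z₀ ⟨hz₀, hz₁⟩
  obtain ⟨r, hr, hr0, hr1⟩ : ∃ r : ℝ, 0 < r ∧ 2 * r < z₀.re ∧ z₀.re + 2 * r < m + 1 := by
    refine ⟨min z₀.re (m + 1 - z₀.re) / 4, ?_, ?_, ?_⟩
    · have : 0 < min z₀.re (m + 1 - z₀.re) := lt_min hz₀ (by linarith)
      positivity
    · linarith [min_le_left z₀.re (m + 1 - z₀.re)]
    · linarith [min_le_right z₀.re (m + 1 - z₀.re)]
  have hKc : IsCompact (Metric.closedBall z₀ (2 * r) ×ˢ K) :=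
    (isCompact_closedBall z₀ (2 * r)).prod hK
  obtain ⟨C₀, hC₀⟩ := hKc.exists_bound_of_continuousOn hG.continuous.continuousOn
  obtain ⟨C₁, hC₁⟩ := hKc.exists_bound_of_continuousOn
    (hG.continuous_iteratedFDeriv (natCast_le_infty (2 * m + 2))).continuousOn
  have hC₀' : ∀ z ∈ Metric.ball z₀ (2 * r), ∀ p, ‖G (z, p)‖ ≤ |C₀| := by
    intro z hz p
    by_cases hp : p ∈ K
    · exact (hC₀ _ ⟨Metric.ball_subset_closedBall hz, hp⟩).trans (le_abs_self _)
    · simp [hGK z p hp]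
  have hC₁' : ∀ z ∈ Metric.ball z₀ (2 * r), ∀ p,
      ‖iteratedFDeriv ℝ (2 * m + 2) G (z, p)‖ ≤ |C₁| := by
    intro z hz p
    by_cases hp : p ∈ K
    · exact (hC₁ _ ⟨Metric.ball_subset_closedBall hz, hp⟩).trans (le_abs_self _)
    · have h0 : (z, p) ∉ tsupport G := by
        have hcl : IsClosed (Set.univ ×ˢ K : Set (ℂ × Euc N)) := isClosed_univ.prod hK.isClosed
        intro h
        refine hp ((closure_minimal ?_ hcl h).2)
        rintro ⟨z', p'⟩ h'
        exact ⟨trivial, by_contra fun hc => h' (hGK z' p' hc)⟩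
      have : iteratedFDeriv ℝ (2 * m + 2) G (z, p) = 0 := by
        by_contra hne
        exact h0 (support_iteratedFDeriv_subset (𝕜 := ℝ) (2 * m + 2) hne)
      simp [this]
  set W : ℝ := ∑ k ∈ Finset.Icc (-((m : ℤ) + 1)) ((m : ℤ) + 1), |wt m k| with hW
  have hW0 : 0 ≤ W := Finset.sum_nonneg fun _ _ => abs_nonneg _
  -- `C₁` serves small `y` through the derivative of order `2m+2`; `W * C₀` bounds the difference
  -- trivially for large `y`.
  set C := max |C₁| (W * |C₀|) with hC
  have hC0 : 0 ≤ C := (abs_nonneg C₁).trans (le_max_left _ _)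
  have hFD : ∀ z ∈ Metric.ball z₀ (2 * r), ∀ y : Euc N,
      ‖∑ k ∈ Finset.Icc (-((m : ℤ) + 1)) ((m : ℤ) + 1), wt m k • G (z, x + (k : ℝ) • y)‖
        ≤ C * min (‖y‖ ^ (2 * m + 2)) 1 := by
    intro z hz y
    rw [mul_min_of_nonneg _ _ hC0]
    refine le_min ?_ ?_
    · have := norm_sum_wt_smul_le m hG (z, x) ((0 : ℂ), y) (C := |C₁|) (fun t => by
        simpa using hC₁' z hz (x + t • y))
      simp only [Prod.smul_mk, smul_zero, Prod.mk_add_mk, add_zero] at this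
      refine this.trans ?_
      rw [Prod.norm_mk, norm_zero, max_eq_right (norm_nonneg _)]
      gcongr
      exact le_max_left _ _
    · refine (norm_sum_le _ _).trans ?_
      rw [mul_one]
      refine le_trans ?_ (le_max_right _ _)
      rw [hW, Finset.sum_mul]
      refine Finset.sum_le_sum fun k _ => ?_
      rw [norm_smul, Real.norm_eq_abs]
      gcongr
      exact hC₀' z hz _
  -- The powers at the two extreme real parts `Re z₀ ± 2r` together dominate: the larger order for
  -- `‖y‖ ≤ 1`, the smaller for `‖y‖ ≥ 1`.
  refine (differentiableAt_integral_of_dominated hr (b := fun y => C *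
    (min (‖y‖ ^ (2 * m + 2)) 1 * ‖y‖ ^ (-(N + 2 * (z₀.re - 2 * r)) : ℝ) +
      min (‖y‖ ^ (2 * m + 2)) 1 * ‖y‖ ^ (-(N + 2 * (z₀.re + 2 * r)) : ℝ)))
    ?_ ?_ ?_ ?_).differentiableWithinAt
  · intro z
    refine AEStronglyMeasurable.mul ?_ (measurable_npow _).aestronglyMeasurable
    refine Continuous.aestronglyMeasurable ?_
    refine continuous_finsetSum _ fun k _ => ?_
    have := hG.continuous
    fun_prop
  · intro y
    refine Differentiable.mul ?_ (differentiable_npow (by fun_prop) y)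
    refine Differentiable.fun_sum fun k _ => ?_
    exact (hGz _).const_smul (wt m k)
  · filter_upwards [ae_ne_zero] with y hy z hz
    have hy0 : 0 < ‖y‖ := norm_pos_iff.2 hy
    rw [norm_mul, norm_npow _ hy, ← mul_add, ← mul_assoc]
    refine mul_le_mul (hFD z hz y) ?_ (by positivity) (by positivity)
    have hre : (-((N : ℂ) + 2 * z)).re = -(N + 2 * z.re) := by simp
    rw [hre]
    have h3 : |z.re - z₀.re| < 2 * r := by
      rw [← Complex.sub_re]
      exact (Complex.abs_re_le_norm _).trans_lt (by rwa [Metric.mem_ball, dist_eq_norm] at hz)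
    obtain ⟨h4, h5⟩ := abs_lt.1 h3
    rcases le_total 1 ‖y‖ with h1 | h1
    · refine le_add_of_le_of_nonneg ?_ (by positivity)
      exact Real.rpow_le_rpow_of_exponent_le h1 (by linarith)
    · refine le_add_of_nonneg_of_le (by positivity) ?_
      exact Real.rpow_le_rpow_of_exponent_ge hy0 h1 (by linarith)
  · refine (Integrable.add ?_ ?_).const_mul C
    · exact integrable_min_norm_pow_mul_rpow _ (by linarith) (by push_cast; linarith)
    · exact integrable_min_norm_pow_mul_rpow _ (by linarith) (by push_cast; linarith)

/-! ### Orders below one half -/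

lemma IsTestFunction.integrable_sub_mul_norm_rpow [NeZero N] {U : Set (Euc N)} {g : Euc N → ℝ}
    (hg : IsTestFunction U g) {s : ℝ} (hs : 0 < s) (hs' : s < 1 / 2) (x : Euc N) :
    Integrable fun y => (g (x + y) - g x) * ‖y‖ ^ (-(N + 2 * s) : ℝ) := by
  obtain ⟨L, hL⟩ := (hg.1.of_le (m := 1) (by norm_cast)).lipschitzWith_of_hasCompactSupport hg.2.1
    one_ne_zero
  obtain ⟨C, hC⟩ := hg.2.1.exists_bound_of_continuous hg.1.continuous
  have hi := (integrable_min_norm_pow_mul_rpow (N := N) 1 (t := 2 * s) (by linarith)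
    (by push_cast; linarith)).const_mul (max (L : ℝ) (2 * C))
  refine hi.mono' ?_ (.of_forall fun y => ?_)
  · have h1 : Continuous fun y => g (x + y) - g x := by
      have := hg.1.continuous
      fun_prop
    refine h1.aestronglyMeasurable.mul (Measurable.aestronglyMeasurable ?_)
    fun_prop
  · rw [norm_mul, Real.norm_of_nonneg (by positivity : 0 ≤ ‖y‖ ^ (-(N + 2 * s) : ℝ)), ← mul_assoc]
    gcongr
    have hm : (0 : ℝ) ≤ max (L : ℝ) (2 * C) := L.2.trans (le_max_left _ _)
    rw [mul_min_of_nonneg _ _ hm, pow_one, mul_one]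
    refine le_min ?_ ?_
    · have := hL.dist_le_mul (x + y) x
      rw [dist_eq_norm, dist_eq_norm, add_sub_cancel_left] at this
      exact this.trans (by gcongr; exact le_max_left _ _)
    · refine le_trans ?_ (le_max_right _ _)
      linarith [norm_sub_le (g (x + y)) (g x), hC (x + y), hC x]

lemma integral_sub_smul_mul_norm_rpow (g : Euc N → ℝ) {s : ℝ} (hs : 0 < s) (x : Euc N) (k : ℝ) :
    ∫ y, (g (x + k • y) - g x) * ‖y‖ ^ (-(N + 2 * s) : ℝ) =
      |k| ^ (2 * s) * ∫ y, (g (x + y) - g x) * ‖y‖ ^ (-(N + 2 * s) : ℝ) := by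
  rcases eq_or_ne k 0 with rfl | hk
  · simp [Real.zero_rpow (by positivity : 2 * s ≠ 0)]
  · have hk0 : 0 < |k| := abs_pos.2 hk
    have h1 := Measure.integral_comp_smul (volume : Measure (Euc N))
      (fun y => (g (x + y) - g x) * ‖y‖ ^ (-(N + 2 * s) : ℝ)) k
    rw [finrank_euclideanSpace, Fintype.card_fin, smul_eq_mul, abs_inv, abs_pow] at h1
    have h2 : ∀ y : Euc N, (g (x + k • y) - g x) * ‖y‖ ^ (-(N + 2 * s) : ℝ) =
        |k| ^ (N + 2 * s : ℝ) * ((g (x + k • y) - g x) * ‖k • y‖ ^ (-(N + 2 * s) : ℝ)) := by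
      intro y
      rw [norm_smul, Real.mul_rpow (norm_nonneg _) (norm_nonneg _), Real.norm_eq_abs,
        Real.rpow_neg hk0.le]
      field_simp
    simp_rw [h2]
    rw [integral_const_mul, h1, Real.rpow_add hk0, Real.rpow_natCast]
    field_simp

/-- Since the weights sum to zero, `g x` can be subtracted in each term. Below order `1/2` the terms
are separately integrable, and scaling extracts `|k|^(2s)`. The resulting factor does not depend on
`g` or `x`, so it needs no evaluation. -/
lemma IsTestFunction.integral_finiteDiff [NeZero N] {U : Set (Euc N)} {g : Euc N → ℝ}
    (hg : IsTestFunction U g) {s : ℝ} (hs : 0 < s) (hs' : s < 1 / 2) (m : ℕ) (x : Euc N) :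
    ∫ y, finiteDiff m g x y / ‖y‖ ^ ((N : ℝ) + 2 * s) =
      (∑ k ∈ Finset.Icc (-((m : ℤ) + 1)) ((m : ℤ) + 1), wt m k * |(k : ℝ)| ^ (2 * s)) *
        ∫ y, (g (x + y) - g x) * ‖y‖ ^ (-(N + 2 * s) : ℝ) := by
  have h1 : ∀ y, finiteDiff m g x y / ‖y‖ ^ ((N : ℝ) + 2 * s) =
      ∑ k ∈ Finset.Icc (-((m : ℤ) + 1)) ((m : ℤ) + 1),
        wt m k * ((g (x + (k : ℝ) • y) - g x) * ‖y‖ ^ (-(N + 2 * s) : ℝ)) := by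
    intro y
    have h2 : finiteDiff m g x y = ∑ k ∈ Finset.Icc (-((m : ℤ) + 1)) ((m : ℤ) + 1),
        wt m k * (g (x + (k : ℝ) • y) - g x) := by
      simp_rw [mul_sub, Finset.sum_sub_distrib, ← Finset.sum_mul, sum_wt, finiteDiff_eq]
      simp
    rw [h2, div_eq_mul_inv, ← Real.rpow_neg (norm_nonneg _), Finset.sum_mul]
    exact Finset.sum_congr rfl fun k _ => mul_assoc _ _ _
  simp_rw [h1]
  rw [integral_finsetSum, Finset.sum_mul]
  · refine Finset.sum_congr rfl fun k _ => ?_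
    rw [integral_const_mul, integral_sub_smul_mul_norm_rpow g hs, mul_assoc]
  · intro k _
    refine Integrable.const_mul ?_ _
    rcases eq_or_ne (k : ℝ) 0 with hk | hk
    · simp [hk]
    · have hk0 : 0 < |(k : ℝ)| := abs_pos.2 hk
      have h3 := ((hg.integrable_sub_mul_norm_rpow hs hs' x).comp_smul hk).const_mul
        (|(k : ℝ)| ^ (N + 2 * s : ℝ))
      refine h3.congr (.of_forall fun y => ?_)
      beta_reduce
      rw [norm_smul, Real.mul_rpow (norm_nonneg _) (norm_nonneg _), Real.norm_eq_abs,
        Real.rpow_neg hk0.le]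
      field_simp

lemma integral_sub_translate (g : Euc N → ℝ) (a : ℝ) (x : Euc N) :
    ∫ y, (g (x + y) - g x) * ‖y‖ ^ a = ∫ y, (g y - g x) * ‖y - x‖ ^ a := by
  rw [← integral_add_left_eq_self (fun y => (g y - g x) * ‖y - x‖ ^ a) x]
  simp

/-- The fundamental solution `‖y‖ ^ (2s-N)` is annihilated away from the origin: the integral is
antisymmetric under the inversion at the sphere through the evaluation point. -/
lemma integral_one_sub_norm_rpow_eq_zero [NeZero N] (s : ℝ) {x : Euc N} (hx : x ≠ 0) :
    ∫ y, (1 - (‖y‖ / ‖x‖) ^ (2 * s - N)) * ‖y - x‖ ^ (-(N + 2 * s) : ℝ) = 0 := by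
  have hb : 0 < ‖x‖ := norm_pos_iff.2 hx
  have hc : 0 < ‖x‖ ^ 2 := by positivity
  have hfix : inversion (‖x‖ ^ 2) 0 x = x := by
    rw [inversion_zero, div_self hc.ne', one_smul]
  -- The substitution formula holds without integrability, so antisymmetry yields zero
  -- unconditionally.
  have key := integral_comp_inversion hc
    (fun y : Euc N => (1 - (‖y‖ / ‖x‖) ^ (2 * s - N)) * ‖y - x‖ ^ (-(N + 2 * s) : ℝ))
  have h2 : ∫ y, (‖x‖ ^ 2 / ‖y‖ ^ 2) ^ N • ((1 - (‖inversion (‖x‖ ^ 2) 0 y‖ / ‖x‖) ^ (2 * s - N)) *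
      ‖inversion (‖x‖ ^ 2) 0 y - x‖ ^ (-(N + 2 * s) : ℝ)) =
      ∫ y, -((1 - (‖y‖ / ‖x‖) ^ (2 * s - N)) * ‖y - x‖ ^ (-(N + 2 * s) : ℝ)) := by
    refine integral_congr_ae ?_
    filter_upwards [ae_ne_zero] with y hy
    have ha : 0 < ‖y‖ := norm_pos_iff.2 hy
    have h3 : ‖inversion (‖x‖ ^ 2) 0 y - x‖ = ‖x‖ / ‖y‖ * ‖y - x‖ := by
      conv_lhs => rw [← hfix, hfix]
      conv_lhs => arg 1; arg 2; rw [← hfix]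
      rw [norm_inversion_sub_inversion hc hy hx]
      field_simp
    have h4 : ‖inversion (‖x‖ ^ 2) 0 y‖ / ‖x‖ = ‖x‖ / ‖y‖ := by
      rw [norm_inversion hc]
      field_simp
    rw [h3, h4, Real.mul_rpow (by positivity) (norm_nonneg _), smul_eq_mul]
    have h5 : (‖x‖ ^ 2 / ‖y‖ ^ 2) ^ N * (‖x‖ / ‖y‖) ^ (-(N + 2 * s) : ℝ) =
        (‖y‖ / ‖x‖) ^ (2 * s - N) := by
      rw [← div_pow, ← pow_mul, ← Real.rpow_natCast, ← Real.rpow_add (by positivity), ← inv_div ‖x‖,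
        Real.inv_rpow (by positivity), ← Real.rpow_neg (by positivity)]
      congr 1
      push_cast
      ring
    have h6 : (‖x‖ / ‖y‖) ^ (2 * s - N) * (‖y‖ / ‖x‖) ^ (2 * s - N) = 1 := by
      rw [← Real.mul_rpow (by positivity) (by positivity)]
      rw [show ‖x‖ / ‖y‖ * (‖y‖ / ‖x‖) = 1 by field_simp, Real.one_rpow]
    calc _ = (1 - (‖x‖ / ‖y‖) ^ (2 * s - N)) * ((‖x‖ ^ 2 / ‖y‖ ^ 2) ^ N *
          (‖x‖ / ‖y‖) ^ (-(N + 2 * s) : ℝ)) * ‖y - x‖ ^ (-(N + 2 * s) : ℝ) := by ring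
      _ = ((‖y‖ / ‖x‖) ^ (2 * s - N) - (‖x‖ / ‖y‖) ^ (2 * s - N) * (‖y‖ / ‖x‖) ^ (2 * s - N)) *
          ‖y - x‖ ^ (-(N + 2 * s) : ℝ) := by rw [h5]; ring
      _ = _ := by rw [h6]; ring
  rw [h2, integral_neg] at key
  linarith

/-- Pointwise form of the substitution, with `a = ‖y‖`, `b = ‖x'‖`, `e = ‖y - x'‖` and `p`, `q` the
values of `u` at `y`, `x'`. The second summand is the error term that integrates to zero. -/
lemma kelvin_rpow_identity (hc : 0 < c) (s : ℝ) {a b : ℝ} (ha : 0 < a) (hb : 0 < b) (e p q : ℝ)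
    (he : 0 ≤ e) :
    (c / a ^ 2) ^ N * (((c / a) ^ (2 * s - N) * p - (c / b) ^ (2 * s - N) * q) *
      (c * e / (a * b)) ^ (-(N + 2 * s) : ℝ)) =
    c ^ (2 * s) * (c / b) ^ (-(N + 2 * s) : ℝ) * ((p - q) * e ^ (-(N + 2 * s) : ℝ) +
      q * ((1 - (a / b) ^ (2 * s - N)) * e ^ (-(N + 2 * s) : ℝ))) := by
  have h1 : (c * e / (a * b)) ^ (-(N + 2 * s) : ℝ) =
      (c / (a * b)) ^ (-(N + 2 * s) : ℝ) * e ^ (-(N + 2 * s) : ℝ) := by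
    rw [← Real.mul_rpow (by positivity) he]
    ring_nf
  have h2 : (c / b) ^ (2 * s - N) = (c / a) ^ (2 * s - N) * (a / b) ^ (2 * s - N) := by
    rw [← Real.mul_rpow (by positivity) (by positivity)]
    congr 1
    field_simp
  have h3 : (c / a ^ 2) ^ N * (c / a) ^ (2 * s - N) * (c / (a * b)) ^ (-(N + 2 * s) : ℝ) =
      c ^ (2 * s) * (c / b) ^ (-(N + 2 * s) : ℝ) := by
    obtain ⟨α, rfl⟩ : ∃ α, Real.exp α = a := ⟨_, Real.exp_log ha⟩
    obtain ⟨β, rfl⟩ : ∃ β, Real.exp β = b := ⟨_, Real.exp_log hb⟩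
    obtain ⟨γ, rfl⟩ : ∃ γ, Real.exp γ = c := ⟨_, Real.exp_log hc⟩
    rw [← Real.exp_nat_mul, ← Real.exp_add]
    simp only [← Real.exp_sub, ← Real.exp_nat_mul, ← Real.exp_mul, ← Real.exp_add]
    congr 1
    push_cast
    ring
  rw [h1, h2, ← h3]
  ring

/-- Covariance under the Kelvin transform for orders below one half. -/
lemma integral_sub_kelvin [NeZero N] (hc : 0 < c) {s : ℝ} (hs : 0 < s) (hs' : s < 1 / 2)
    {u : Euc N → ℝ} (hu : IsTestFunction {0}ᶜ u) {x : Euc N} (hx : x ≠ 0) :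
    ∫ y, (kelvin s c 0 u (x + y) - kelvin s c 0 u x) * ‖y‖ ^ (-(N + 2 * s) : ℝ) =
      c ^ (2 * s) * ‖x‖ ^ (-(N + 2 * s) : ℝ) *
        ∫ y, (u (inversion c 0 x + y) - u (inversion c 0 x)) * ‖y‖ ^ (-(N + 2 * s) : ℝ) := by
  have hg := hu.kelvin hc s subset_rfl
  set g := kelvin s c 0 u with hgdef
  set x' := inversion c 0 x with hx'
  have hxx : inversion c 0 x' = x := inversion_inversion hc x
  have hx0 : x' ≠ 0 := fun h => hx ((inversion_eq_zero hc).1 h)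
  have hi1 : Integrable fun y => (g y - g x) * ‖y - x‖ ^ (-(N + 2 * s) : ℝ) := by
    have := (hg.integrable_sub_mul_norm_rpow hs hs' x).comp_sub_right x
    simpa using this
  have hi2 : Integrable fun y => (u y - u x') * ‖y - x'‖ ^ (-(N + 2 * s) : ℝ) := by
    have := (hu.integrable_sub_mul_norm_rpow hs hs' x').comp_sub_right x'
    simpa using this
  rw [integral_sub_translate, integral_sub_translate, ← integral_comp_inversion hc]
  set A := c ^ (2 * s) * ‖x‖ ^ (-(N + 2 * s) : ℝ) with hA
  have hA0 : A ≠ 0 := by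
    have := norm_pos_iff.2 hx
    positivity
  have hae : (fun y => (c / ‖y‖ ^ 2) ^ N • ((g (inversion c 0 y) - g x) *
        ‖inversion c 0 y - x‖ ^ (-(N + 2 * s) : ℝ))) =ᵐ[volume]
      fun y => A * ((u y - u x') * ‖y - x'‖ ^ (-(N + 2 * s) : ℝ) +
        u x' * ((1 - (‖y‖ / ‖x'‖) ^ (2 * s - N)) * ‖y - x'‖ ^ (-(N + 2 * s) : ℝ))) := by
    filter_upwards [ae_ne_zero] with y hy
    have hκ : inversion c 0 y ≠ 0 := fun h => hy ((inversion_eq_zero hc).1 h)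
    have h1 : g (inversion c 0 y) = (c / ‖y‖) ^ (2 * s - N) * u y := by
      rw [hgdef, kelvin_zero_apply hκ, inversion_inversion hc, norm_inversion hc]
    have h2 : g x = (c / ‖x'‖) ^ (2 * s - N) * u x' := by
      rw [hgdef, kelvin_zero_apply hx, ← hx', ← norm_inversion hc, hxx]
    have h3 : ‖inversion c 0 y - x‖ = c * ‖y - x'‖ / (‖y‖ * ‖x'‖) := by
      rw [← norm_inversion_sub_inversion hc hy hx0, hxx]
    have h4 : ‖x‖ = c / ‖x'‖ := by rw [← norm_inversion hc, hxx]
    rw [h1, h2, h3, smul_eq_mul, hA, h4]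
    exact kelvin_rpow_identity hc s (norm_pos_iff.2 hy) (norm_pos_iff.2 hx0) _ _ _ (norm_nonneg _)
  rw [integral_congr_ae hae, integral_const_mul]
  congr 1
  by_cases hux : u x' = 0
  · simp [hux]
  -- Integrability of the error term is inherited: the transformed integrand and the one for `u` are
  -- integrable, hence so is their difference.
  · have hi3 : Integrable fun y => u x' *
        ((1 - (‖y‖ / ‖x'‖) ^ (2 * s - N)) * ‖y - x'‖ ^ (-(N + 2 * s) : ℝ)) := by
      have h5 := ((integrable_comp_inversion_iff hc _).2 hi1).congr hae
      rw [integrable_const_mul_iff hA0.isUnit] at h5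
      exact (h5.sub hi2).congr (.of_forall fun y => by simp)
    rw [integral_add hi2 hi3, integral_const_mul, integral_one_sub_norm_rpow_eq_zero s hx0, mul_zero,
      add_zero]

/-! ### Analytic continuation in the order -/

/-- Joint smoothness in the order and the point is what the derivative bound on `ℂ × ℝ^N` requires;
`w` vanishes where the power is singular. -/
lemma contDiff_npow_mul {w : Euc N → ℝ} (hw : IsTestFunction {0}ᶜ w) :
    ContDiff ℝ ∞ fun q : ℂ × Euc N => npow (2 * q.1 - N) q.2 * (w q.2 : ℂ) := by
  refine contDiff_iff_contDiffAt.2 fun q => ?_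
  by_cases hq : q.2 = 0
  · have h1 := hw.eventuallyEq_zero (x := q.2) (by simp [hq])
    have h2 : (fun q : ℂ × Euc N => npow (2 * q.1 - N) q.2 * (w q.2 : ℂ)) =ᶠ[nhds q] fun _ => 0 := by
      filter_upwards [continuous_snd.continuousAt.eventually h1] with p hp
      simp [hp]
    exact contDiffAt_const.congr_of_eventuallyEq h2
  · have hl : ContDiffAt ℝ ∞ (fun q : ℂ × Euc N => Real.log ‖q.2‖) q :=
      (contDiffAt_snd.norm ℝ hq).log (norm_ne_zero_iff.2 hq)
    have hof : ContDiff ℝ ∞ (fun r : ℝ => (r : ℂ)) := Complex.ofRealCLM.contDiff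
    have h1 : ContDiffAt ℝ ∞ (fun q : ℂ × Euc N => (2 * q.1 - N : ℂ)) q :=
      (contDiffAt_const.mul contDiffAt_fst).sub contDiffAt_const
    exact (h1.mul (hof.contDiffAt.comp q hl)).cexp.mul
      (hof.contDiffAt.comp q (hw.1.contDiffAt.comp q contDiffAt_snd))

lemma integral_finiteDiff_ofReal [NeZero N] (m : ℕ) (s : ℝ) (g : Euc N → ℝ) (G : Euc N → ℂ)
    (hG : ∀ p, G p = g p) (x : Euc N) :
    ∫ y : Euc N, (∑ k ∈ Finset.Icc (-((m : ℤ) + 1)) ((m : ℤ) + 1), wt m k • G (x + (k : ℝ) • y)) *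
        npow (-(N + 2 * (s : ℂ))) y =
      ((∫ y, finiteDiff m g x y / ‖y‖ ^ ((N : ℝ) + 2 * s) : ℝ) : ℂ) := by
  rw [← integral_complex_ofReal]
  refine integral_congr_ae ?_
  filter_upwards [ae_ne_zero] with y hy
  have h1 : (-(N + 2 * (s : ℂ))) = ((-(N + 2 * s) : ℝ) : ℂ) := by push_cast; rfl
  rw [h1, npow_ofReal _ hy, finiteDiff_eq, div_eq_mul_inv, ← Real.rpow_neg (norm_nonneg _)]
  simp only [hG, Complex.real_smul]
  push_cast
  rfl

lemma integral_finiteDiff_kelvin [NeZero N] (hc : 0 < c) (m : ℕ) {s : ℝ} (hs : 0 < s)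
    (hs' : s < m + 1) {u : Euc N → ℝ} (hu : IsTestFunction {0}ᶜ u) {x : Euc N} (hx : x ≠ 0) :
    ∫ y, finiteDiff m (kelvin s c 0 u) x y / ‖y‖ ^ ((N : ℝ) + 2 * s) =
      c ^ (2 * s) * ‖x‖ ^ (-(N + 2 * s) : ℝ) *
        ∫ y, finiteDiff m u (inversion c 0 x) y / ‖y‖ ^ ((N : ℝ) + 2 * s) := by
  set S : Set ℂ := {z | 0 < z.re ∧ z.re < m + 1} with hS
  have hSo : IsOpen S := (isOpen_lt continuous_const Complex.continuous_re).inter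
    (isOpen_lt Complex.continuous_re continuous_const)
  have hSc : IsPreconnected S := by
    have : Convex ℝ S := (convex_halfSpace_re_gt 0).inter (convex_halfSpace_re_lt (m + 1))
    exact this.isPreconnected
  have hw := hu.comp_inversion_compl hc
  have hof : ContDiff ℝ ∞ (fun r : ℝ => (r : ℂ)) := Complex.ofRealCLM.contDiff
  have hD1 := differentiableOn_integral_finiteDiff m (contDiff_npow_mul hw)
    (fun p => (differentiable_npow (g := fun z => 2 * z - N) (by fun_prop) p).mul_const
      (u (inversion c 0 p) : ℂ)) hw.2.1
    (fun z p hp => by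
      have : u (inversion c 0 p) = 0 :=
        image_eq_zero_of_notMem_tsupport (f := fun x => u (inversion c 0 x)) hp
      simp [this]) x
  have hD2 := differentiableOn_integral_finiteDiff m (G := fun q : ℂ × Euc N => (u q.2 : ℂ))
    (hof.comp (hu.1.comp contDiff_snd)) (fun p => differentiable_const (u p : ℂ)) hu.2.1
    (fun z p hp => by simp [image_eq_zero_of_notMem_tsupport hp]) (inversion c 0 x)
  have hD3 : Differentiable ℂ fun z : ℂ => Complex.exp (2 * z * Real.log c) *
      npow (-(N + 2 * z)) x :=
    Differentiable.mul (by fun_prop) (differentiable_npow (by fun_prop) x)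
  have hD4 := hD3.differentiableOn.mul hD2
  have hval : ∀ t : ℝ, ∀ p : Euc N, npow (2 * (t : ℂ) - N) p * ((u (inversion c 0 p) : ℝ) : ℂ) =
      ((kelvin t c 0 u p : ℝ) : ℂ) := by
    intro t p
    rw [kelvin_zero_eq (hu.eq_zero (by simp))]
    rcases eq_or_ne p 0 with rfl | hp
    · simp [hu.eq_zero (x := 0) (by simp)]
    · have h1 : 2 * (t : ℂ) - N = ((2 * t - N : ℝ) : ℂ) := by push_cast; rfl
      rw [h1, npow_ofReal _ hp]
      push_cast
      rfl
  have hexp : ∀ t : ℝ, Complex.exp (2 * (t : ℂ) * Real.log c) * npow (-(N + 2 * (t : ℂ))) x =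
      ((c ^ (2 * t) * ‖x‖ ^ (-(N + 2 * t) : ℝ) : ℝ) : ℂ) := by
    intro t
    have h1 : (-(N + 2 * (t : ℂ))) = ((-(N + 2 * t) : ℝ) : ℂ) := by push_cast; rfl
    rw [h1, npow_ofReal _ hx, Real.rpow_def_of_pos hc]
    push_cast
    ring_nf
  -- The point `1/4` lies in the strip for every `m` and is an accumulation point of the real orders
  -- in `(0, 1/2)`, where the identity is known.
  have hq : (((1 / 4 : ℝ) : ℝ) : ℂ) ∈ S := by
    have : (0 : ℝ) ≤ m := Nat.cast_nonneg m
    refine ⟨?_, ?_⟩ <;> rw [Complex.ofReal_re] <;> linarith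
  have hEq := AnalyticOnNhd.eqOn_of_preconnected_of_frequently_eq (hD1.analyticOnNhd hSo)
    (hD4.analyticOnNhd hSo) hSc hq (by
      have ht : Filter.Tendsto (fun r : ℝ => (r : ℂ)) (nhdsWithin (1 / 4 : ℝ) {1 / 4}ᶜ)
          (nhdsWithin (((1 / 4 : ℝ) : ℝ) : ℂ) {(((1 / 4 : ℝ) : ℝ) : ℂ)}ᶜ) := by
        refine tendsto_nhdsWithin_of_tendsto_nhds_of_eventually_within _
          (Complex.continuous_ofReal.continuousAt.tendsto.mono_left nhdsWithin_le_nhds) ?_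
        filter_upwards [self_mem_nhdsWithin] with r hr h
        exact hr (Complex.ofReal_injective h)
      refine ht.frequently (Filter.Eventually.frequently ?_)
      have hI : Set.Ioo (0 : ℝ) (1 / 2) ∈ nhdsWithin (1 / 4 : ℝ) {1 / 4}ᶜ :=
        mem_nhdsWithin_of_mem_nhds (Ioo_mem_nhds (by norm_num) (by norm_num))
      filter_upwards [hI] with t ht
      rw [integral_finiteDiff_ofReal m t (kelvin t c 0 u) _ (hval t)]
      rw [Pi.mul_apply, hexp t, integral_finiteDiff_ofReal m t u _ (fun _ => rfl),
        ← Complex.ofReal_mul, (hu.kelvin hc t subset_rfl).integral_finiteDiff ht.1 ht.2,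
        hu.integral_finiteDiff ht.1 ht.2, integral_sub_kelvin hc ht.1 ht.2 hu hx]
      congr 1
      ring)
  have hsS : (s : ℂ) ∈ S := ⟨by simpa using hs, by simpa using hs'⟩
  have h := hEq hsS
  rw [Pi.mul_apply, hexp s, integral_finiteDiff_ofReal m s u _ (fun _ => rfl)] at h
  beta_reduce at h
  rw [integral_finiteDiff_ofReal m s (kelvin s c 0 u) _ (hval s)] at h
  exact_mod_cast h

/-- Covariance of `(-Δ)^s` under the Kelvin transform centered at the origin. -/
lemma fracLaplacian_kelvin_zero [NeZero N] (hc : 0 < c) {s : ℝ} (hs : 0 < s)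
    {u : Euc N → ℝ} (hu : IsTestFunction {0}ᶜ u) {x : Euc N} (hx : x ≠ 0) :
    fracLaplacian s (kelvin s c 0 u) x =
      c ^ (2 * s) * ‖x‖ ^ (-(N + 2 * s) : ℝ) * fracLaplacian s u (inversion c 0 x) := by
  by_cases h : (⌊s⌋₊ : ℝ) = s
  · simp only [fracLaplacian, if_pos h]
    generalize ⌊s⌋₊ = m at h
    subst h
    rw [neg_laplacian_iterate (hu.kelvin hc _ subset_rfl), neg_laplacian_iterate hu,
      kelvin_zero_eq (hu.eq_zero (by simp)), laplacian_iterate_kelvin hc hu]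
    rw [show (-2 * m - N : ℝ) = -(N + 2 * m) by ring, show (2 * m : ℝ) = ((2 * m : ℕ) : ℝ) by simp,
      Real.rpow_natCast]
    push_cast
    ring
  · simp only [fracLaplacian, if_neg h]
    -- The normalization constant is a common factor of both sides.
    rw [integral_finiteDiff_kelvin hc _ hs (Nat.lt_floor_add_one s) hu hx]
    ring

/-! ### Translations -/

lemma inversion_eq_translate (c : ℝ) (v x : Euc N) :
    inversion c v x = inversion c 0 (x + v) - v := by
  simp [inversion]

lemma kelvin_eq_translate (s c : ℝ) (v : Euc N) (u : Euc N → ℝ) (x : Euc N) :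
    kelvin s c v u x = kelvin s c 0 (fun y => u (y - v)) (x + v) := by
  simp only [kelvin, inversion_eq_translate c v, neg_zero, add_zero, add_eq_zero_iff_eq_neg]

lemma laplacian_translate (f : Euc N → ℝ) (v : Euc N) :
    Δ (fun y => f (y + v)) = fun x => Δ f (x + v) := by
  ext x
  simp only [InnerProductSpace.laplacian_eq_iteratedFDeriv_orthonormalBasis _
    (EuclideanSpace.basisFun (Fin N) ℝ), iteratedFDeriv_comp_add_right]

lemma fracLaplacian_translate (s : ℝ) (f : Euc N → ℝ) (v x : Euc N) :
    fracLaplacian s (fun y => f (y + v)) x = fracLaplacian s f (x + v) := by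
  unfold fracLaplacian
  split_ifs
  · generalize ⌊s⌋₊ = m
    induction m generalizing x with
    | zero => rfl
    | succ m ih =>
      rw [Function.iterate_succ_apply', Function.iterate_succ_apply', funext ih, Pi.neg_apply,
        Pi.neg_apply, laplacian_translate]
  · simp only [finiteDiff, add_right_comm]

lemma IsTestFunction.translate {U : Set (Euc N)} {u : Euc N → ℝ} (hu : IsTestFunction U u)
    (v : Euc N) : IsTestFunction ((fun x => x + v) ⁻¹' U) (fun x => u (x + v)) := by
  have h : tsupport (fun x => u (x + v)) = (fun x => x + v) ⁻¹' tsupport u :=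
    tsupport_comp_eq_preimage u (Homeomorph.addRight v)
  refine ⟨hu.1.comp (contDiff_id.add contDiff_const),
    hu.2.1.comp_homeomorph (Homeomorph.addRight v), ?_⟩
  rw [h]
  exact Set.preimage_mono hu.2.2

/-! ### The weighted space -/

lemma one_add_norm_rpow_pos (p : ℝ) (x : Euc N) : 0 < 1 + ‖x‖ ^ p := by positivity

lemma continuous_one_add_norm_rpow {p : ℝ} (hp : 0 ≤ p) :
    Continuous fun x : Euc N => 1 + ‖x‖ ^ p :=
  continuous_const.add (continuous_norm.rpow_const fun _ => Or.inr hp)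

/-- The weight is continuous and positive, so weighted integrability already contains local
integrability. -/
lemma memL1s_iff {s : ℝ} (hs : 0 < s) {u : Euc N → ℝ} :
    MemL1s s u ↔ Integrable fun x => u x / (1 + ‖x‖ ^ ((N : ℝ) + 2 * s)) := by
  have hcont := continuous_one_add_norm_rpow (N := N) (p := N + 2 * s) (by positivity)
  constructor
  · rintro ⟨h1, h2⟩
    refine h2.mono (h1.aestronglyMeasurable.div₀ hcont.aestronglyMeasurable)
      (.of_forall fun x => ?_)
    rw [norm_div, norm_div, Real.norm_eq_abs |u x|, abs_abs, Real.norm_eq_abs]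
  · intro h
    constructor
    · have h3 := h.locallyIntegrable.continuous_mul hcont
      simpa only [mul_div_cancel₀ _ (one_add_norm_rpow_pos _ _).ne'] using h3
    · refine h.abs.congr (.of_forall fun x => ?_)
      simp only [abs_div, abs_of_pos (one_add_norm_rpow_pos _ x)]

lemma MemL1s.translate {s : ℝ} (hs : 0 < s) {u : Euc N → ℝ} (hu : MemL1s s u) (v : Euc N) :
    MemL1s s (fun x => u (x + v)) := by
  rw [memL1s_iff hs] at hu ⊢
  set p : ℝ := N + 2 * s with hp
  have hp0 : 0 ≤ p := by positivity
  have hcont := continuous_one_add_norm_rpow (N := N) hp0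
  have hcont' : Continuous fun x : Euc N => (1 + ‖x + v‖ ^ p) / (1 + ‖x‖ ^ p) :=
    (hcont.comp (continuous_id.add continuous_const)).div hcont
      fun x => (one_add_norm_rpow_pos p x).ne'
  refine ((hu.comp_add_right v).mul_bdd (c := 1 + 2 ^ p * (1 + ‖v‖ ^ p))
    hcont'.aestronglyMeasurable (.of_forall fun x => ?_)).congr (.of_forall fun x => ?_)
  · have h0 := one_add_norm_rpow_pos p x
    rw [Real.norm_of_nonneg (by positivity), div_le_iff₀ h0]
    have h1 : ‖x + v‖ ^ p ≤ 2 ^ p * (‖x‖ ^ p + ‖v‖ ^ p) := by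
      have h2 : ‖x + v‖ ≤ 2 * max ‖x‖ ‖v‖ := by
        linarith [norm_add_le x v, le_max_left ‖x‖ ‖v‖, le_max_right ‖x‖ ‖v‖]
      refine (Real.rpow_le_rpow (norm_nonneg _) h2 hp0).trans ?_
      rw [Real.mul_rpow (by norm_num) (by positivity)]
      gcongr
      rcases max_choice ‖x‖ ‖v‖ with h | h <;> rw [h]
      · exact le_add_of_nonneg_right (by positivity)
      · exact le_add_of_nonneg_left (by positivity)
    have h3 : (0 : ℝ) < 2 ^ p := by positivity
    have h4 : 0 ≤ ‖x‖ ^ p := by positivity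
    have h5 : 0 ≤ ‖v‖ ^ p := by positivity
    nlinarith [mul_nonneg h3.le h4, mul_nonneg h3.le h5, mul_nonneg (mul_nonneg h3.le h4) h5]
  · have h0 := (one_add_norm_rpow_pos p x).ne'
    have h1 := (one_add_norm_rpow_pos p (x + v)).ne'
    beta_reduce
    field_simp

lemma IsDistribHarmonic.translate {s : ℝ} (hs : 0 < s) {U : Set (Euc N)} {u : Euc N → ℝ}
    (hu : IsDistribHarmonic s U u) (v : Euc N) :
    IsDistribHarmonic s ((fun x => x + v) ⁻¹' U) (fun x => u (x + v)) := by
  refine ⟨hu.1.translate hs v, fun φ hφ => ?_⟩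
  have h1 := hφ.translate (-v)
  rw [← Set.preimage_comp] at h1
  have h2 := hu.2 (fun x => φ (x + -v)) (h1.mono fun x hx => by simpa using hx)
  rw [← integral_add_right_eq_self _ v] at h2
  simpa [fracLaplacian_translate] using h2

lemma isDistribHarmonic_translate_iff {s : ℝ} (hs : 0 < s) {U : Set (Euc N)} {u : Euc N → ℝ}
    (v : Euc N) : IsDistribHarmonic s ((fun x => x + v) ⁻¹' U) (fun x => u (x + v)) ↔
      IsDistribHarmonic s U u := by
  refine ⟨fun h => ?_, fun h => h.translate hs v⟩
  simpa [← Set.preimage_comp, Function.comp_def] using h.translate hs (-v)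

/-! ### The Kelvin transform of distributionally harmonic functions -/

lemma kelvin_apply_inversion (hc : 0 < c) (s : ℝ) (u : Euc N → ℝ) {y : Euc N} (hy : y ≠ 0) :
    kelvin s c 0 u (inversion c 0 y) = (c / ‖y‖) ^ (2 * s - N) * u y := by
  rw [kelvin_zero_apply fun h => hy ((inversion_eq_zero hc).1 h), inversion_inversion hc,
    norm_inversion hc]

lemma kelvin_jacobian_identity (hc : 0 < c) (s : ℝ) {a : ℝ} (ha : 0 < a) :
    (c / a ^ 2) ^ N * (c / a) ^ (2 * s - N) = c ^ (2 * s) / a ^ (N + 2 * s) := by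
  obtain ⟨α, rfl⟩ : ∃ α, Real.exp α = a := ⟨_, Real.exp_log ha⟩
  obtain ⟨γ, rfl⟩ : ∃ γ, Real.exp γ = c := ⟨_, Real.exp_log hc⟩
  simp only [← Real.exp_sub, ← Real.exp_nat_mul, ← Real.exp_mul, ← Real.exp_add]
  congr 1
  push_cast
  ring

/-- After substitution the two weights differ by a multiple of `(1+‖x‖^p)/(c^p+‖x‖^p)`, which is
bounded. -/
lemma MemL1s.kelvin [NeZero N] (hc : 0 < c) {s : ℝ} (hs : 0 < s) {u : Euc N → ℝ}
    (hu : MemL1s s u) : MemL1s s (kelvin s c 0 u) := by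
  rw [memL1s_iff hs] at hu ⊢
  rw [← integrable_comp_inversion_iff hc]
  set p : ℝ := N + 2 * s with hp
  have hp0 : 0 ≤ p := by positivity
  have hcp : 0 < c ^ p := by positivity
  have hcont := continuous_one_add_norm_rpow (N := N) hp0
  have hcont' : Continuous fun x : Euc N => c ^ (2 * s) * ((1 + ‖x‖ ^ p) / (c ^ p + ‖x‖ ^ p)) := by
    refine continuous_const.mul (hcont.div ?_ fun x => ?_)
    · exact continuous_const.add (continuous_norm.rpow_const fun _ => Or.inr hp0)
    · positivity
  refine (hu.mul_bdd (c := c ^ (2 * s) * max 1 (c ^ p)⁻¹)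
    hcont'.aestronglyMeasurable (.of_forall fun x => ?_)).congr ?_
  · rw [Real.norm_of_nonneg (by positivity)]
    gcongr
    have h4 : 0 ≤ ‖x‖ ^ p := by positivity
    rw [div_le_iff₀ (by positivity), mul_add]
    refine add_le_add ?_ ?_
    · calc (1 : ℝ) = (c ^ p)⁻¹ * c ^ p := (inv_mul_cancel₀ hcp.ne').symm
        _ ≤ _ := by gcongr; exact le_max_right _ _
    · exact le_mul_of_one_le_left h4 (le_max_left _ _)
  · filter_upwards [ae_ne_zero] with y hy
    have ha : 0 < ‖y‖ := norm_pos_iff.2 hy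
    have hap : 0 < ‖y‖ ^ p := by positivity
    have h1 : (c / ‖y‖) ^ p = c ^ p / ‖y‖ ^ p := Real.div_rpow hc.le ha.le p
    rw [kelvin_apply_inversion hc s u hy, norm_inversion hc, h1, smul_eq_mul,
      mul_div_assoc (_ ^ (2 * s - N : ℝ)), ← mul_assoc ((c / ‖y‖ ^ 2) ^ N),
      kelvin_jacobian_identity hc s ha, ← hp]
    field_simp
    ring

lemma image_inversion_image (hc : 0 < c) (U : Set (Euc N)) :
    inversion c 0 '' (inversion c 0 '' U) = U := by
  rw [Set.image_image]
  simp [inversion_inversion hc]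

lemma image_inversion_subset (hc : 0 < c) {U : Set (Euc N)} (hU : U ⊆ {0}ᶜ) :
    inversion c 0 '' U ⊆ {0}ᶜ :=
  (Set.image_mono hU).trans (image_inversion_compl_zero hc).subset

/-- Test `u` against the transform of `φ`: by covariance and the Jacobian identity, substitution
turns one pairing into the other. -/
lemma IsDistribHarmonic.kelvin [NeZero N] (hc : 0 < c) {s : ℝ} (hs : 0 < s) {U : Set (Euc N)}
    (hU : U ⊆ {0}ᶜ) {u : Euc N → ℝ} (hu : IsDistribHarmonic s U u) :
    IsDistribHarmonic s (inversion c 0 '' U) (kelvin s c 0 u) := by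
  refine ⟨hu.1.kelvin hc hs, fun φ hφ => ?_⟩
  have hκU := image_inversion_subset hc hU
  have hψ := hφ.kelvin hc s hκU
  rw [image_inversion_image hc] at hψ
  rw [← hu.2 _ hψ, ← integral_comp_inversion hc]
  refine integral_congr_ae ?_
  filter_upwards [ae_ne_zero] with y hy
  have ha : 0 < ‖y‖ := norm_pos_iff.2 hy
  rw [fracLaplacian_kelvin_zero hc hs (hφ.mono hκU) hy, kelvin_apply_inversion hc s u hy,
    smul_eq_mul, ← mul_assoc, ← mul_assoc, kelvin_jacobian_identity hc s ha, Real.rpow_neg ha.le]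
  ring

/-- The converse applies the forward direction to the transform of `u`; two transforms give
`c^(2s-N) u` almost everywhere. -/
lemma isDistribHarmonic_kelvin_iff [NeZero N] (hc : 0 < c) {s : ℝ} (hs : 0 < s) {U : Set (Euc N)}
    (hU : U ⊆ {0}ᶜ) {u : Euc N → ℝ} (hu : MemL1s s u) :
    IsDistribHarmonic s U u ↔ IsDistribHarmonic s (inversion c 0 '' U) (kelvin s c 0 u) := by
  refine ⟨fun h => h.kelvin hc hs hU, fun h => ⟨hu, fun φ hφ => ?_⟩⟩
  have h1 := h.kelvin hc hs (image_inversion_subset hc hU)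
  rw [image_inversion_image hc] at h1
  have h2 := h1.2 φ hφ
  have h3 : ∫ x, PointInversion.kelvin s c 0 (PointInversion.kelvin s c 0 u) x *
      fracLaplacian s φ x = ∫ x, c ^ (2 * s - N) * (u x * fracLaplacian s φ x) := by
    refine integral_congr_ae ?_
    filter_upwards [ae_ne_zero] with y hy
    have ha : 0 < ‖y‖ := norm_pos_iff.2 hy
    rw [kelvin_zero_apply hy, kelvin_apply_inversion hc s u hy, ← mul_assoc (‖y‖ ^ _),
      ← Real.mul_rpow ha.le (by positivity), mul_div_cancel₀ _ ha.ne', mul_assoc]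
  rw [h3, integral_const_mul] at h2
  exact (mul_eq_zero.1 h2).resolve_left (by positivity)

/-- Covariance of `(-Δ)^s` under the Kelvin transform. -/
lemma fracLaplacian_kelvin [NeZero N] (hc : 0 < c) {s : ℝ} (hs : 0 < s) (v : Euc N)
    {u : Euc N → ℝ} (hu : IsTestFunction {-v}ᶜ u) {x : Euc N} (hx : x ≠ -v) :
    fracLaplacian s (kelvin s c v u) x =
      c ^ (2 * s) * (fracLaplacian s u (inversion c v x) / ‖x + v‖ ^ (N + 2 * s)) := by
  have hu0 : IsTestFunction {0}ᶜ (fun y => u (y + -v)) :=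
    (hu.translate (-v)).mono fun y hy => by simpa [neg_add_eq_zero, eq_comm] using hy
  have hxv : x + v ≠ 0 := fun h => hx (add_eq_zero_iff_eq_neg.1 h)
  rw [funext (kelvin_eq_translate s c v u), fracLaplacian_translate s _ v]
  simp only [sub_eq_add_neg]
  rw [fracLaplacian_kelvin_zero hc hs hu0 hxv, fracLaplacian_translate, ← sub_eq_add_neg,
    ← inversion_eq_translate, Real.rpow_neg (norm_nonneg _)]
  ring

end PointInversion

open PointInversion

theorem proposition1p6 (N : ℕ) (hN : 1 ≤ N) (s c : ℝ) (hs : 0 < s) (hc : 0 < c)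
    (v : EuclideanSpace ℝ (Fin N)) :
    (∀ u : EuclideanSpace ℝ (Fin N) → ℝ, PointInversion.IsTestFunction {-v}ᶜ u →
      ∀ x : EuclideanSpace ℝ (Fin N), x ≠ -v →
        PointInversion.fracLaplacian s (PointInversion.kelvin s c v u) x =
            c ^ (2 * s) *
              (PointInversion.kelvin s c v (PointInversion.fracLaplacian s u) x
                / ‖x + v‖ ^ (4 * s)) ∧
          PointInversion.fracLaplacian s
              (fun y => u (PointInversion.inversion c v y) / ‖y + v‖ ^ ((N : ℝ) - 2 * s)) x =
            c ^ (2 * s) *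
              (PointInversion.fracLaplacian s u (PointInversion.inversion c v x)
                / ‖x + v‖ ^ ((N : ℝ) + 2 * s))) ∧
    (∀ U : Set (EuclideanSpace ℝ (Fin N)), IsOpen U → U ⊆ {-v}ᶜ →
      ∀ u : EuclideanSpace ℝ (Fin N) → ℝ, PointInversion.MemL1s s u →
        (PointInversion.IsDistribHarmonic s U u ↔
          PointInversion.IsDistribHarmonic s (PointInversion.inversion c v '' U)
            (PointInversion.kelvin s c v u))) := by
  have : NeZero N := ⟨by omega⟩
  refine ⟨fun u hu x hx => ⟨?_, ?_⟩, fun U _ hU u hu => ?_⟩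
  · have hxv : 0 < ‖x + v‖ := norm_pos_iff.2 fun h => hx (add_eq_zero_iff_eq_neg.1 h)
    rw [fracLaplacian_kelvin hc hs v hu hx]
    simp only [kelvin, if_neg hx]
    rw [mul_div_right_comm, ← Real.rpow_sub hxv, show 2 * s - N - 4 * s = -(N + 2 * s) by ring,
      Real.rpow_neg hxv.le]
    ring
  · rw [← fracLaplacian_kelvin hc hs v hu hx]
    congr 1
    ext y
    by_cases hy : y = -v
    -- At `-v` the inversion returns `-v`, where `u` vanishes, so both forms of the transform are
    -- zero.
    · subst hy
      simp [kelvin, inversion, hu.eq_zero (x := -v) (by simp)]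
    · rw [kelvin, if_neg hy, ← neg_sub, Real.rpow_neg (norm_nonneg _)]
      field_simp
  · have hU0 : (fun x => x + -v) ⁻¹' U ⊆ {0}ᶜ := fun x hx h => hU hx (by simp_all)
    have himg : inversion c v '' U =
        (fun x => x + v) ⁻¹' (inversion c 0 '' ((fun x => x + -v) ⁻¹' U)) := by
      ext y
      simp only [Set.mem_image, Set.mem_preimage, inversion_eq_translate c v]
      constructor
      · rintro ⟨x, hx, rfl⟩
        exact ⟨x + v, by simpa using hx, by simp⟩
      · rintro ⟨x, hx, h⟩
        exact ⟨x + -v, hx, by simp [h]⟩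
    rw [← isDistribHarmonic_translate_iff hs (-v),
      isDistribHarmonic_kelvin_iff hc hs hU0 (hu.translate hs (-v)), himg,
      funext (kelvin_eq_translate s c v u)]
    simp only [sub_eq_add_neg]
    rw [isDistribHarmonic_translate_iff hs v]

end
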